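/- **Setting.** Let $d,n,k\ge 1$ be integers, $X\subseteq\mathbb R^d$, and let $f:\mathbb R^d\to[0,\infty)$ be a probability density that vanishes outside $X$; $\Lambda=\sup_X f\in(0,\infty]$. Let $v_d$ be the volume of the unit ball, $B(x,r)$ the closed Euclidean ball, and $Z_\sigma=Z+B(0,\sigma)$ for $Z\subseteq\mathbb R^d$, $\sigma>0$. A set is called connected if any two of its points are joined by a path in it. The supremum over the empty set is $-\infty$. *Algorithms.* Let $X_n=\{x_1,\dots,x_n\}$ be an i.i.d. sample from $f$ and let $r_k(x_i)=\min\{r: B(x_i,r)\text{ contains } k \text{ data points}\}$ ($x_i$ included). For $0\le r\le\infty$ the level-$r$ graph has nodes $\{x_i: r_k(x_i)\le r\}$ and an edge between nodes $x_i\ne x_j$ iff $\|x_i-x_j\|\le\alpha r$ (Algorithm 1), respectively iff $\|x_i-x_j\|\le\alpha\min(r_k(x_i),r_k(x_j))$ or, in its other variant, $\|x_i-x_j\|\le\alpha\max(r_k(x_i),r_k(x_j))$ (Algorithm 2). *Pruning.* Let $C_\delta=2C_o\log(2/\delta)$. For $\lambda>0$ let $r(\lambda)$ be the $r$ with $v_dr^d\lambda=\frac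 kn+\frac{C_\delta}{n}\sqrt{kd\log n}$, and $r(0)=\infty$. Pruning of level $r$ with parameter $\tilde\epsilon$: put $\tilde\lambda_r=\frac1{v_dr^d}\big(\frac kn-\frac{C_\delta}{n}\sqrt{kd\log n}\big)-\tilde\epsilon$, and connect any two components of the level-$r$ graph that lie in the same connected component of the (unpruned) graph of level $r(\max(\tilde\lambda_r,0))$. Let $\mathbb C_n(r)$ be the set of components at level $r$ after pruning. **Theorem.** There are absolute constants $C_o,C>0$ such that the following holds for all $d,n,k,X,f$ as above. Let $0<\delta,\epsilon<1$ and $\tilde\epsilon>0$. Run Algorithm 1 or 2 with $$\sqrt2\le\alpha\le2,\qquad k\ \ge\ C\cdot\frac{d\log n}{\epsilon^2}\cdot\log^2\frac2\delta ,$$ followed by pruning with parameter $\tilde\epsilon$. Then with probability at least $1-\delta$ both statements below hold for every $\sigma>0$, where $$\lambda_o=\frac{k}{nv_d(\sigma/2)^d}\cdot\frac{1+\epsilon}{1-\epsilon}+\frac{\tilde\epsilon}{1-\epsilon},$$ or, for Algorithm 2, the maximum of this quantity and $\frac{\Lambda}{k}\,C\,d\log n\cdot\log\frac2\delta$. (i)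 *Recovery of true clusters.* Let $A,A'\subseteq X$ be any two sets with $\lambda=\inf_{A_\sigma\cup A'_\sigma}f\ge\lambda_o$, and suppose that there is a set $S$ such that any path in the convex hull of $X$ (that is, in $X$ itself when $X$ is convex) from $A$ to $A'$ intersects $S$, and $\sup_{S_\sigma}f<(1-2\epsilon)\lambda-\tilde\epsilon$. Then all points of $(A\cup A')\cap X_n$ are present in $\mathbb C_n(r(\lambda))$; no component in $\mathbb C_n(r(\lambda))$ contains both a point of $A\cap X_n$ and a point of $A'\cap X_n$; if $A$ is connected, then $A\cap X_n$ lies in a single component in $\mathbb C_n(r(\lambda))$, and likewise for $A'$. In particular, if $A,A'$ are connected, $A\cap X_n$ and $A'\cap X_n$ are individually connected in $\mathbb C_n(r(\lambda))$ but lie in two separate components. (ii) *Removal of false clusters.* Assume $\tilde\epsilon\ge2\sup_{x,x'\in\mathbb R^d,\ \|x-x'\|\le\sigma}|f(x)-f(x')|$. Let $A_n,A_n'$ be the vertex sets of two disjoint components in $\mathbb C_n(r)$, for any $r\in(0,\infty)$. If $\lambda=\inf_{A_n\cup A_n'}f\ge\lambda_o$, then $A_n$ and $A_n'$ are disconnected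 in the level set $\{x\in X:f(x)\ge\lambda\}$: no path in it joins a point of $A_n$ to a point of $A_n'$. -/

import Mathlib

open MeasureTheory
open scoped ENNReal

noncomputable section

namespace ClusterTree

/-- `ℝ^d` with the Euclidean norm. -/
abbrev Space (d : ℕ) := EuclideanSpace ℝ (Fin d)

/-- The volume `v_d` of the unit ball of `ℝ^d`. -/
def unitBallVolume (d : ℕ) : ℝ := (volume (Metric.closedBall (0 : Space d) 1)).toReal

/-- `f` is a probability density on `ℝ^d` supported on `X`: it vanishes outside `X`
(and possibly at some points of `X` too). -/
structure IsDensityOn {d : ℕ} (X : Set (Space d)) (f : Space d → ℝ) : Prop where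
  measurable : Measurable f
  nonneg : ∀ x, 0 ≤ f x
  eq_zero_of_notMem : ∀ x, x ∉ X → f x = 0
  lintegral_eq_one : ∫⁻ x, ENNReal.ofReal (f x) = 1

/-- The law of one observation. -/
def densityMeasure {d : ℕ} (f : Space d → ℝ) : Measure (Space d) :=
  volume.withDensity fun x => ENNReal.ofReal (f x)

/-- The law of an i.i.d. sample of size `n` drawn from `f`. -/
def sampleMeasure {d : ℕ} (f : Space d → ℝ) (n : ℕ) : Measure (Fin n → Space d) :=
  Measure.pi fun _ => densityMeasure f

open scoped Pointwise in
/-- The buffered set `Z_σ = Z + B(0, σ)`, with `B(0, σ)` the closed ball. -/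
def buffer {d : ℕ} (Z : Set (Space d)) (σ : ℝ) : Set (Space d) :=
  Z + Metric.closedBall 0 σ

/-- The supremum of `f` over `Z`, as an extended real (`⊥` if `Z` is empty, `⊤` if `f` is not
bounded above on `Z`). -/
def supOn {d : ℕ} (f : Space d → ℝ) (Z : Set (Space d)) : EReal :=
  ⨆ x ∈ Z, (f x : EReal)

/-- `sup_{‖x - x'‖ ≤ σ} |f x - f x'|`, over all pairs of points of `ℝ^d`. -/
def oscillation {d : ℕ} (f : Space d → ℝ) (σ : ℝ) : EReal :=
  ⨆ (x : Space d) (x' : Space d) (_ : ‖x - x'‖ ≤ σ), ((|f x - f x'| : ℝ) : EReal)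

/-! ### The two cluster tree algorithms -/

/-- Algorithm 1 (robust single linkage), and Algorithm 2 with either of its two edge rules. -/
inductive Algorithm
  | linkage
  | mutualNearestNeighbor
  | nearestNeighbor

/-- `r_k(x_i) = min {r : B(x_i, r) contains k data points}` (`x_i` itself counts); it is `∞` if
there are fewer than `k` data points. -/
def knnRadius {d n : ℕ} (k : ℕ) (x : Fin n → Space d) (i : Fin n) : ℝ≥0∞ :=
  sInf {r : ℝ≥0∞ | k ≤ Set.ncard {j : Fin n | edist (x j) (x i) ≤ r}}

/-- The nodes of the graph at level `r ∈ [0, ∞]`. -/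
def nodes {d n : ℕ} (k : ℕ) (x : Fin n → Space d) (r : ℝ≥0∞) : Set (Fin n) :=
  {i | knnRadius k x i ≤ r}

/-- Two nodes at level `r` are joined by an edge if their distance is at most `α` times this. -/
def edgeScale {d n : ℕ} (alg : Algorithm) (k : ℕ) (x : Fin n → Space d) (r : ℝ≥0∞)
    (i j : Fin n) : ℝ≥0∞ :=
  match alg with
  | .linkage => r
  | .mutualNearestNeighbor => min (knnRadius k x i) (knnRadius k x j)
  | .nearestNeighbor => max (knnRadius k x i) (knnRadius k x j)

theorem edgeScale_comm {d n : ℕ} (alg : Algorithm) (k : ℕ) (x : Fin n → Space d) (r : ℝ≥0∞)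
    (i j : Fin n) : edgeScale alg k x r i j = edgeScale alg k x r j i := by
  cases alg
  · rfl
  · exact min_comm _ _
  · exact max_comm _ _

/-- The graph at level `r`, as a graph on all indices: its nodes are `nodes k x r`, and the
other indices are isolated and ignored. -/
def levelGraph {d n : ℕ} (alg : Algorithm) (α : ℝ) (k : ℕ) (x : Fin n → Space d) (r : ℝ≥0∞) :
    SimpleGraph (Fin n) where
  Adj i j := i ≠ j ∧ i ∈ nodes k x r ∧ j ∈ nodes k x r ∧
    edist (x i) (x j) ≤ ENNReal.ofReal α * edgeScale alg k x r i j
  symm := ⟨fun i j h =>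
    ⟨h.1.symm, h.2.2.1, h.2.1, by rw [edist_comm, edgeScale_comm]; exact h.2.2.2⟩⟩
  loopless := ⟨fun _ h => h.1 rfl⟩

/-! ### Pruning -/

/-- The constant `C_δ = 2 C_o log (2 / δ)`. -/
def confidenceConst (C₀ δ : ℝ) : ℝ := 2 * C₀ * Real.log (2 / δ)

/-- `(C_δ / n) √(k d log n)`, with `Cδ` in the role of `C_δ`. -/
def deviation (Cδ : ℝ) (d n k : ℕ) : ℝ := Cδ / n * √(k * d * Real.log n)

/-- `r(lam)`: the solution `r` of `v_d r ^ d lam = k / n + (C_δ / n) √(k d log n)`. It is `∞`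
for `lam = 0`. -/
def levelRadius (Cδ : ℝ) (d n k : ℕ) (lam : ℝ) : ℝ≥0∞ :=
  (ENNReal.ofReal (k / n + deviation Cδ d n k) /
    ENNReal.ofReal (unitBallVolume d * lam)) ^ (1 / d : ℝ)

/-- `(1 / (v_d r ^ d)) (k / n - (C_δ / n) √(k d log n)) - ε'`, with `ε'` the pruning parameter. -/
def lookupDensity (Cδ ε' : ℝ) (d n k : ℕ) (r : ℝ≥0∞) : ℝ :=
  1 / (unitBallVolume d * r.toReal ^ d) * (k / n - deviation Cδ d n k) - ε'

/-- The level that the pruning procedure looks up when it prunes level `r`. -/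
def lookupRadius (Cδ ε' : ℝ) (d n k : ℕ) (r : ℝ≥0∞) : ℝ≥0∞ :=
  levelRadius Cδ d n k (max (lookupDensity Cδ ε' d n k r) 0)

/-- The graph at level `r` after pruning, again with set of nodes `nodes k x r`: nodes that are
in the same connected component at the looked up level get connected. -/
def prunedGraph {d n : ℕ} (alg : Algorithm) (α : ℝ) (k : ℕ) (Cδ ε' : ℝ) (x : Fin n → Space d)
    (r : ℝ≥0∞) : SimpleGraph (Fin n) where
  Adj i j := i ≠ j ∧ i ∈ nodes k x r ∧ j ∈ nodes k x r ∧
    ((levelGraph alg α k x r).Adj i j ∨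
      (levelGraph alg α k x (lookupRadius Cδ ε' d n k r)).Reachable i j)
  symm := ⟨fun _ _ h => ⟨h.1.symm, h.2.2.1, h.2.1, h.2.2.2.imp (fun e => e.symm)
    (fun e => e.symm)⟩⟩
  loopless := ⟨fun _ h => h.1 rfl⟩

/-- `T` is (the set of nodes of) a connected component of the pruned tree at level `r`. -/
def IsPrunedCluster {d n : ℕ} (alg : Algorithm) (α : ℝ) (k : ℕ) (Cδ ε' : ℝ)
    (x : Fin n → Space d) (r : ℝ≥0∞) (T : Set (Fin n)) : Prop :=
  ∃ i ∈ nodes k x r,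
    T = {j | j ∈ nodes k x r ∧ (prunedGraph alg α k Cδ ε' x r).Reachable i j}

/-- The data points in `A` all lie in a single connected component of the pruned tree at
level `r`. -/
def SampleConnected {d n : ℕ} (alg : Algorithm) (α : ℝ) (k : ℕ) (Cδ ε' : ℝ)
    (x : Fin n → Space d) (r : ℝ≥0∞) (A : Set (Space d)) : Prop :=
  ∀ i j, x i ∈ A → x j ∈ A → i ∈ nodes k x r ∧ j ∈ nodes k x r ∧
    (prunedGraph alg α k Cδ ε' x r).Reachable i j

/-- The data points in `A` and in `A'` are all present in the pruned tree at level `r`, and no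
connected component there contains a data point of `A` and one of `A'`. -/
def SampleSeparated {d n : ℕ} (alg : Algorithm) (α : ℝ) (k : ℕ) (Cδ ε' : ℝ)
    (x : Fin n → Space d) (r : ℝ≥0∞) (A A' : Set (Space d)) : Prop :=
  (∀ i, x i ∈ A ∪ A' → i ∈ nodes k x r) ∧
    ∀ i j, x i ∈ A → x j ∈ A' → ¬ (prunedGraph alg α k Cδ ε' x r).Reachable i j

/-! ### The two guarantees -/

/-- The density threshold `λ_o`. -/
def densityThreshold {d : ℕ} (alg : Algorithm) (X : Set (Space d)) (f : Space d → ℝ)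
    (C δ ε ε' σ : ℝ) (n k : ℕ) : EReal :=
  let base : ℝ :=
    k / (n * unitBallVolume d * (σ / 2) ^ d) * ((1 + ε) / (1 - ε)) + ε' / (1 - ε)
  match alg with
  | .linkage => (base : EReal)
  | _ => max (base : EReal)
      (supOn f X * ((C * d * Real.log n * Real.log (2 / δ) / k : ℝ) : EReal))

/-- Every path from `A` to `A'` in `K` meets `S`. -/
def Separates {d : ℕ} (K S A A' : Set (Space d)) : Prop :=
  ∀ a ∈ A, ∀ a' ∈ A', ∀ γ : Path a a', (∀ t, γ t ∈ K) → ∃ t, γ t ∈ S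

/-- Recovery of true clusters, for the sample `x` and the buffer width `σ`. -/
def RecoversTrueClusters {d n : ℕ} (alg : Algorithm) (X : Set (Space d)) (f : Space d → ℝ)
    (C Cδ δ ε ε' α : ℝ) (k : ℕ) (σ : ℝ) (x : Fin n → Space d) : Prop :=
  ∀ (A A' : Set (Space d)) (lam : ℝ), A ⊆ X → A' ⊆ X →
    lam = sInf (f '' (buffer A σ ∪ buffer A' σ)) →
    densityThreshold alg X f C δ ε ε' σ n k ≤ (lam : EReal) →
    (∃ S : Set (Space d), Separates (convexHull ℝ X) S A A' ∧
      supOn f (buffer S σ) < (((1 - 2 * ε) * lam - ε' : ℝ) : EReal)) →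
    (IsPathConnected A →
      SampleConnected alg α k Cδ ε' x (levelRadius Cδ d n k lam) A) ∧
    (IsPathConnected A' →
      SampleConnected alg α k Cδ ε' x (levelRadius Cδ d n k lam) A') ∧
    SampleSeparated alg α k Cδ ε' x (levelRadius Cδ d n k lam) A A'

/-- Removal of false clusters, for the sample `x` and the scale `σ`. -/
def RemovesFalseClusters {d n : ℕ} (alg : Algorithm) (X : Set (Space d)) (f : Space d → ℝ)
    (C Cδ δ ε ε' α : ℝ) (k : ℕ) (σ : ℝ) (x : Fin n → Space d) : Prop :=
  2 * oscillation f σ ≤ (ε' : EReal) →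
  ∀ (r : ℝ) (T T' : Set (Fin n)) (lam : ℝ), 0 < r →
    IsPrunedCluster alg α k Cδ ε' x (ENNReal.ofReal r) T →
    IsPrunedCluster alg α k Cδ ε' x (ENNReal.ofReal r) T' →
    Disjoint T T' →
    lam = sInf ((fun i => f (x i)) '' (T ∪ T')) →
    densityThreshold alg X f C δ ε ε' σ n k ≤ (lam : EReal) →
    ∀ i ∈ T, ∀ j ∈ T', ¬ JoinedIn {y | y ∈ X ∧ lam ≤ f y} (x i) (x j)

end ClusterTree

end

/-!
A sample is typical if balls around data points whose mass is a little more than `k / n` contain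
`k` data points, those whose mass is a little less do not, and every half-ball of moderate mass in
a region of high density contains a data point.

The mass of the ball around `x_i` with `x_j` on its boundary is essentially uniformly distributed,
so Chernoff's bound controls all balls around `x_i` at once. For half-balls a finite net is needed,
although `X` may be unbounded: a ball on which `f` is large carries a box below the graph of `f`,
and there is room only for few disjoint such boxes, as the region below the graph has volume `1`.
The slack in a half-ball absorbs the error of the approximation in the net.

Let the sample be typical. A data point `y` in the half-ball of radius `s` around `a` facing `b`,
where `‖a - b‖ ≤ s`, satisfies `‖y - b‖ ≤ √2 s`. So data points that follow a connected set of high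
density form a chain whose steps are edges of the graph. Conversely, a chain of edges at level `r`
stays within `r` of its nodes (this uses `α ≤ 2`); if it has to meet `S`, some node is close to `S`,
and its ball contains `k` data points in spite of its low mass. Pruning a level looks up another
one, of slightly lower density, to which both arguments still apply.
-/

noncomputable section

namespace ClusterTree

open Filter Topology ProbabilityTheory

/-! ### Chernoff bounds -/

section Chernoff

theorem ncard_eq_sum_indicator {Ω ι : Type*} [Fintype ι] (S : ι → Set Ω) (ω : Ω) :
    ({j | ω ∈ S j}.ncard : ℝ) = ∑ j, (S j).indicator (fun _ => (1 : ℝ)) ω := by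
  classical
  rw [Set.ncard_eq_toFinset_card', Set.toFinset_ofPred, Finset.natCast_card_filter]
  simp only [Set.indicator_apply]

variable {Ω : Type*} [MeasurableSpace Ω]

theorem mgf_indicator_le_exp (P : Measure Ω) [IsProbabilityMeasure P] {S : Set Ω}
    (hS : MeasurableSet S) (s : ℝ) :
    mgf (S.indicator fun _ => (1 : ℝ)) P s ≤ Real.exp (P.real S * (Real.exp s - 1)) := by
  have hexp : ∀ ω, Real.exp (s * S.indicator (fun _ => 1) ω) =
      S.indicator (fun _ => Real.exp s - 1) ω + 1 := by
    intro ω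
    by_cases hω : ω ∈ S <;> simp [hω]
  calc mgf (S.indicator fun _ => (1 : ℝ)) P s = P.real S * (Real.exp s - 1) + 1 := by
        simp_rw [mgf, hexp]
        rw [integral_add ((integrable_const _).indicator hS) (integrable_const _),
          integral_indicator_const _ hS]
        simp
    _ ≤ _ := Real.add_one_le_exp _

theorem measureReal_le_mul_ncard_le_exp {P : Measure Ω} {ι : Type*} [Fintype ι]
    {S : ι → Set Ω} (hS : ∀ j, MeasurableSet (S j)) (hindep : iIndepSet S P) {s B : ℝ}
    (hB : ∀ j, P.real (S j) * (Real.exp s - 1) ≤ B) (a : ℝ) :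
    P.real {ω | a ≤ s * ({j | ω ∈ S j}.ncard : ℝ)} ≤ Real.exp (Fintype.card ι * B - a) := by
  have := hindep.isProbabilityMeasure
  set N : ι → Ω → ℝ := fun j => (S j).indicator fun _ => 1
  have hcount : ∀ ω, ({j | ω ∈ S j}.ncard : ℝ) = (∑ j, N j) ω := fun ω => by
    rw [ncard_eq_sum_indicator, Finset.sum_apply]
  have hN : ∀ j, Measurable (N j) := fun j => measurable_const.indicator (hS j)
  have hNint : ∀ j, Integrable (fun ω => Real.exp (s * N j ω)) P := fun j =>
    integrable_exp_mul_of_mem_Icc (a := 0) (b := 1) (hN j).aemeasurable (ae_of_all _ fun ω =>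
      ⟨Set.indicator_nonneg (fun _ _ => zero_le_one) _,
        Set.indicator_le_self' (fun _ _ => zero_le_one) _⟩)
  have hNindep : iIndepFun N P := hindep.iIndepFun_indicator
  have hint : Integrable (fun ω => Real.exp (1 * (s * (∑ j, N j) ω))) P := by
    simpa only [one_mul] using hNindep.integrable_exp_mul_sum hN fun j _ => hNint j
  have hmgf : mgf (∑ j, N j) P s ≤ Real.exp (Fintype.card ι * B) := by
    rw [hNindep.mgf_sum hN, Real.exp_nat_mul, ← Finset.card_univ, ← Finset.prod_const]
    exact Finset.prod_le_prod (fun _ _ => mgf_nonneg) fun j _ =>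
      (mgf_indicator_le_exp P (hS j) s).trans (Real.exp_le_exp.2 (hB j))
  simp_rw [hcount]
  refine (measure_ge_le_exp_mul_mgf a zero_le_one hint).trans ?_
  rw [mgf_const_mul, mul_one, sub_eq_neg_add, Real.exp_add, neg_one_mul]
  gcongr

variable (ν : Measure Ω) [IsProbabilityMeasure ν]

theorem measureReal_pi_le_mul_ncard_le_exp {ι : Type*} [Fintype ι] {S : Set Ω}
    (hS : MeasurableSet S) {s B : ℝ} (hB : ν.real S * (Real.exp s - 1) ≤ B) (a : ℝ) :
    (Measure.pi fun _ : ι => ν).real {y | a ≤ s * ({j | y j ∈ S}.ncard : ℝ)} ≤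
      Real.exp (Fintype.card ι * B - a) := by
  have hmp : ∀ j, MeasurePreserving (Function.eval j) (Measure.pi fun _ : ι => ν) ν :=
    measurePreserving_eval _
  refine measureReal_le_mul_ncard_le_exp (S := fun j => Function.eval j ⁻¹' S)
    (fun j => (hmp j).measurable hS) ?_ (fun j => ?_) a
  · have hindep : iIndepFun (fun (j : ι) (y : ι → Ω) => y j) (Measure.pi fun _ : ι => ν) :=
      iIndepFun_pi (X := fun _ => id) fun _ => aemeasurable_id
    exact (iIndepSet_iff_meas_biInter fun j => (hmp j).measurable hS).2 fun J =>
      hindep.measure_inter_preimage_eq_mul J fun _ _ => hS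
  · rwa [measureReal_def, (hmp j).measure_preimage hS.nullMeasurableSet]

theorem measureReal_pi_le_mul_ncard_ne_le_exp {n : ℕ} (i : Fin n) {S : Set (Ω × Ω)}
    (hS : MeasurableSet S) {s B : ℝ} (hB : ∀ c, ν.real {y | (c, y) ∈ S} * (Real.exp s - 1) ≤ B)
    (a : ℝ) :
    (Measure.pi fun _ : Fin n => ν).real
      {x | a ≤ s * ({j | j ≠ i ∧ (x i, x j) ∈ S}.ncard : ℝ)} ≤ Real.exp ((n - 1) * B - a) := by
  obtain ⟨m, rfl⟩ : ∃ m, n = m + 1 := ⟨n - 1, by have := i.2; omega⟩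
  set T : Set (Ω × (Fin m → Ω)) := {p | a ≤ s * ({j | (p.1, p.2 j) ∈ S}.ncard : ℝ)}
  have hT : MeasurableSet T := by
    refine measurableSet_le measurable_const (Measurable.const_mul ?_ _)
    refine (measurable_of_countable (Nat.cast : ℕ → ℝ)).comp (measurable_ncard.comp ?_)
    exact measurable_set_iff.2 fun j => hS.mem.comp
      (measurable_fst.prodMk ((measurable_pi_apply j).comp measurable_snd))
  have hpre : {x : Fin (m + 1) → Ω | a ≤ s * ({j | j ≠ i ∧ (x i, x j) ∈ S}.ncard : ℝ)} =
      MeasurableEquiv.piFinSuccAbove (fun _ => Ω) i ⁻¹' T := by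
    ext x
    have himage : {j | j ≠ i ∧ (x i, x j) ∈ S} =
        i.succAbove '' {j | (x i, x (i.succAbove j)) ∈ S} := by
      ext j
      cases j using i.succAboveCases <;> simp
    rw [Set.mem_ofPred_eq, himage, Set.ncard_image_of_injective _ i.succAbove_right_injective]
    rfl
  have hslice : ∀ c, (Measure.pi fun _ : Fin m => ν) (Prod.mk c ⁻¹' T) ≤
      ENNReal.ofReal (Real.exp (m * B - a)) := fun c => by
    have := measureReal_pi_le_mul_ncard_le_exp (ι := Fin m) ν (measurable_prodMk_left hS) (hB c) a
    rw [Fintype.card_fin] at this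
    exact (ENNReal.le_ofReal_iff_toReal_le (measure_ne_top _ _) (Real.exp_pos _).le).2 this
  rw [hpre, measureReal_def, (measurePreserving_piFinSuccAbove (fun _ => ν) i).measure_preimage
    hT.nullMeasurableSet, Measure.prod_apply hT]
  refine ENNReal.toReal_le_of_le_ofReal (Real.exp_pos _).le ((lintegral_mono hslice).trans ?_)
  simp

end Chernoff

/-! ### The number of sample points in a ball -/

section ProbabilityIntegralTransform

variable (μ : Measure ℝ) [IsProbabilityMeasure μ]

theorem monotone_measureReal_Iic : Monotone fun t => μ.real (Set.Iic t) :=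
  fun _ _ h => measureReal_mono (Set.Iic_subset_Iic.2 h)

theorem measureReal_setOf_measureReal_Iic_le {p : ℝ} (hp : 0 ≤ p) :
    μ.real {t | μ.real (Set.Iic t) ≤ p} ≤ p := by
  have hm := measurableSet_le (monotone_measureReal_Iic μ).measurable (measurable_const (a := p))
  rw [measureReal_def, hm.measure_eq_iSup_isCompact]
  refine ENNReal.toReal_le_of_le_ofReal hp (iSup₂_le fun K hKsub => iSup_le fun hK => ?_)
  rcases K.eq_empty_or_nonempty with rfl | hne
  · simp
  obtain ⟨t, ht⟩ := hK.exists_isGreatest hne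
  calc μ K ≤ μ (Set.Iic t) := measure_mono fun _ h => ht.2 h
    _ ≤ ENNReal.ofReal p := (ENNReal.le_ofReal_iff_toReal_le (measure_ne_top _ _) hp).2
      (hKsub ht.1)

theorem le_measureReal_setOf_measureReal_Iic_lt [NullSingletonClass μ] {p : ℝ} (hp : p ≤ 1) :
    p ≤ μ.real {t | μ.real (Set.Iic t) < p} := by
  have hm := measurableSet_le (measurable_const (a := p)) (monotone_measureReal_Iic μ).measurable
  have hcompl : {t | μ.real (Set.Iic t) < p} = {t | p ≤ μ.real (Set.Iic t)}ᶜ := by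
    ext t; simp
  suffices h : μ.real {t | p ≤ μ.real (Set.Iic t)} ≤ 1 - p by
    rw [hcompl, probReal_compl_eq_one_sub hm]
    linarith
  have hp' : 0 ≤ 1 - p := sub_nonneg.2 hp
  rw [measureReal_def, hm.measure_eq_iSup_isCompact]
  refine ENNReal.toReal_le_of_le_ofReal hp' (iSup₂_le fun K hKsub => iSup_le fun hK => ?_)
  rcases K.eq_empty_or_nonempty with rfl | hne
  · simp
  obtain ⟨t, ht⟩ := hK.exists_isLeast hne
  have hIoi : μ.real (Set.Ioi t) ≤ 1 - p := by
    rw [← Set.compl_Iic, probReal_compl_eq_one_sub measurableSet_Iic]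
    linarith [show p ≤ μ.real (Set.Iic t) from hKsub ht.1]
  calc μ K ≤ μ (Set.Ici t) := measure_mono fun _ h => ht.2 h
    _ = μ (Set.Ioi t) := (measure_congr Ioi_ae_eq_Ici).symm
    _ ≤ ENNReal.ofReal (1 - p) :=
      (ENNReal.le_ofReal_iff_toReal_le (measure_ne_top _ _) hp').2 hIoi

end ProbabilityIntegralTransform

theorem lowerTail_exponent_le {k Δ w : ℝ} (hk : 1 ≤ k) (hΔ : 0 ≤ Δ) (hΔk : Δ ≤ k)
    (hw : k + Δ - 1 ≤ w) :
    w * (Real.exp (-(Δ / (4 * k))) - 1) + Δ / (4 * k) * (k - 1) ≤ -(Δ ^ 2 / (8 * k)) := by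
  set t := Δ / (4 * k) with ht
  have ht0 : 0 ≤ t := by positivity
  have ht1 : t ≤ 1 := by rw [ht, div_le_one (by positivity)]; linarith
  have hexp : Real.exp (-t) - 1 ≤ -t + t ^ 2 := by
    have := Real.abs_exp_sub_one_sub_id_le (x := -t) (by rwa [abs_neg, abs_of_nonneg ht0])
    linarith [(abs_le.1 this).2, neg_sq t]
  have hΔt : Δ = 4 * k * t := by rw [ht]; field_simp
  calc w * (Real.exp (-t) - 1) + t * (k - 1)
      ≤ (k + Δ - 1) * (Real.exp (-t) - 1) + t * (k - 1) := by
        gcongr ?_ + _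
        exact mul_le_mul_of_nonpos_right hw (sub_nonpos.2 (Real.exp_le_one_iff.2 (by linarith)))
    _ ≤ (k + Δ - 1) * (-t + t ^ 2) + t * (k - 1) := by gcongr; linarith
    _ ≤ -(t * Δ) / 2 := by nlinarith [sq_nonneg t]
    _ = -(Δ ^ 2 / (8 * k)) := by rw [ht]; field_simp; ring

theorem upperTail_exponent_le {k Δ w : ℝ} (hΔ : 2 ≤ Δ) (hΔk : Δ ≤ k) (hw : w ≤ k - Δ) :
    w * (Real.exp (Δ / (4 * k)) - 1) - Δ / (4 * k) * (k - 1) ≤ -(Δ ^ 2 / (16 * k)) := by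
  have hk : 0 < k := by linarith
  set t := Δ / (4 * k) with ht
  have ht0 : 0 ≤ t := by positivity
  have ht1 : t ≤ 1 := by rw [ht, div_le_one (by positivity)]; linarith
  have hexp : Real.exp t - 1 ≤ t + t ^ 2 := by
    have := Real.abs_exp_sub_one_sub_id_le (x := t) (by rwa [abs_of_nonneg ht0])
    linarith [(abs_le.1 this).2]
  have hΔt : Δ = 4 * k * t := by rw [ht]; field_simp
  calc w * (Real.exp t - 1) - t * (k - 1)
      ≤ (k - Δ) * (Real.exp t - 1) - t * (k - 1) := by
        gcongr
        exact sub_nonneg.2 (Real.one_le_exp ht0)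
    _ ≤ (k - Δ) * (t + t ^ 2) - t * (k - 1) := by gcongr
    _ ≤ -(t * Δ) / 4 := by nlinarith [sq_nonneg t, mul_nonneg ht0 (sub_nonneg.2 hΔ)]
    _ = -(Δ ^ 2 / (16 * k)) := by rw [ht]; field_simp; norm_num

section Counts

variable {M : Type*} [PseudoMetricSpace M] [MeasurableSpace M] (ν : Measure M)

/-- The mass of the closed ball centred at `p.1` with `p.2` on its boundary. For a random point
`p.2` of law `ν`, it is the distribution function of `dist p.2 p.1` at its own value, and so
essentially uniformly distributed. -/
def reachMass (p : M × M) : ℝ :=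
  ν.real (Metric.closedBall p.1 (dist p.2 p.1))

variable [OpensMeasurableSpace M]

theorem measureReal_map_dist_Iic (c : M) (r : ℝ) :
    (ν.map (dist · c)).real (Set.Iic r) = ν.real (Metric.closedBall c r) :=
  map_measureReal_apply (by fun_prop) measurableSet_Iic

variable [IsProbabilityMeasure ν]

theorem measureReal_setOf_reachMass_le (c : M) {p : ℝ} (hp : 0 ≤ p) :
    ν.real {y | reachMass ν (c, y) ≤ p} ≤ p := by
  have hdist : Measurable (dist · c) := by fun_prop
  have := Measure.isProbabilityMeasure_map (μ := ν) hdist.aemeasurable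
  have h := measureReal_setOf_measureReal_Iic_le (ν.map (dist · c)) hp
  rw [map_measureReal_apply hdist
    (measurableSet_le (monotone_measureReal_Iic _).measurable measurable_const)] at h
  simpa only [Set.preimage_ofPred_eq, reachMass, measureReal_map_dist_Iic] using h

theorem le_measureReal_setOf_reachMass_lt (hν : ∀ c r, ν (Metric.sphere c r) = 0) (c : M) {p : ℝ}
    (hp : p ≤ 1) : p ≤ ν.real {y | reachMass ν (c, y) < p} := by
  have hdist : Measurable (dist · c) := by fun_prop
  have := Measure.isProbabilityMeasure_map (μ := ν) hdist.aemeasurable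
  have : NullSingletonClass (ν.map (dist · c)) :=
    ⟨fun r => by rw [Measure.map_apply hdist (measurableSet_singleton r)]; exact hν c r⟩
  have h := le_measureReal_setOf_measureReal_Iic_lt (ν.map (dist · c)) hp
  rw [map_measureReal_apply hdist
    (measurableSet_lt (monotone_measureReal_Iic _).measurable measurable_const)] at h
  simpa only [Set.preimage_ofPred_eq, reachMass, measureReal_map_dist_Iic] using h

theorem measurable_reachMass [SecondCountableTopology M] : Measurable (reachMass ν) := by
  have hs : MeasurableSet {q : (M × M) × M | dist q.2 q.1.1 ≤ dist q.1.2 q.1.1} :=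
    (isClosed_le (by fun_prop) (by fun_prop)).measurableSet
  exact (measurable_measure_prodMk_left (ν := ν) hs).ennreal_toReal

variable [SecondCountableTopology M]

theorem measureReal_exists_heavy_ball_ncard_lt_le (hν : ∀ c r, ν (Metric.sphere c r) = 0)
    {n k : ℕ} (hk : 1 ≤ k) {Δ : ℝ} (hΔ : 0 ≤ Δ) (hΔk : Δ ≤ k) (i : Fin n) :
    (Measure.pi fun _ : Fin n => ν).real
      {x | ∃ r : ℝ, (k + Δ) / n ≤ ν.real (Metric.closedBall (x i) r) ∧
        {j | dist (x j) (x i) ≤ r}.ncard < k} ≤ Real.exp (-(Δ ^ 2 / (8 * k))) := by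
  have hk1 : (1 : ℝ) ≤ k := by exact_mod_cast hk
  have hn0 : (0 : ℝ) < n := by exact_mod_cast i.pos
  set p : ℝ := (k + Δ) / n with hp
  have hp0 : 0 < p := by positivity
  have hnp : n * p = k + Δ := by rw [hp]; field_simp
  set t : ℝ := Δ / (4 * k)
  have ht0 : 0 ≤ t := by positivity
  set S : Set (M × M) := {q | reachMass ν q < p}
  have hSm : MeasurableSet S := measurableSet_lt (measurable_reachMass ν) measurable_const
  rcases lt_or_ge 1 p with hp1 | hp1
  · have hempty : {x : Fin n → M | ∃ r : ℝ, p ≤ ν.real (Metric.closedBall (x i) r) ∧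
        {j | dist (x j) (x i) ≤ r}.ncard < k} = ∅ :=
      Set.eq_empty_iff_forall_notMem.2 fun x ⟨r, hr, _⟩ =>
        (hr.trans measureReal_le_one).not_gt hp1
    rw [hempty, measureReal_empty]
    positivity
  have key := measureReal_pi_le_mul_ncard_ne_le_exp ν i hSm (s := -t) (a := -t * (k - 1))
    fun c => mul_le_mul_of_nonpos_right (le_measureReal_setOf_reachMass_lt ν hν c hp1)
      (sub_nonpos.2 (Real.exp_le_one_iff.2 (neg_nonpos.2 ht0)))
  refine (measureReal_mono ?_).trans (key.trans (Real.exp_le_exp.2 ?_))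
  · rintro x ⟨r, hr, hc⟩
    have hr0 : 0 ≤ r := by
      by_contra! hr0
      rw [Metric.closedBall_eq_empty.2 hr0, measureReal_empty] at hr
      linarith
    have hsub : insert i {j | j ≠ i ∧ (x i, x j) ∈ S} ⊆ {j | dist (x j) (x i) ≤ r} := by
      rintro j (rfl | ⟨-, hj⟩)
      · simpa using hr0
      · by_contra hlt
        exact (hr.trans (measureReal_mono
          (Metric.closedBall_subset_closedBall (not_le.1 hlt).le))).not_gt hj
    have hcount := (Set.ncard_le_ncard hsub).trans_lt hc
    rw [Set.ncard_insert_of_notMem (by simp)] at hcount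
    have : ({j | j ≠ i ∧ (x i, x j) ∈ S}.ncard : ℝ) + 1 ≤ k := by exact_mod_cast hcount.le
    exact mul_le_mul_of_nonpos_left (by linarith) (neg_nonpos.2 ht0)
  · have := lowerTail_exponent_le (w := (n - 1) * p) hk1 hΔ hΔk (by linarith)
    linarith

theorem measureReal_exists_light_ball_le_ncard_le {n k : ℕ} {Δ : ℝ} (hΔ : 2 ≤ Δ) (hΔk : Δ ≤ k)
    (i : Fin n) :
    (Measure.pi fun _ : Fin n => ν).real
      {x | ∃ r : ℝ, ν.real (Metric.closedBall (x i) r) ≤ (k - Δ) / n ∧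
        k ≤ {j | dist (x j) (x i) ≤ r}.ncard} ≤ Real.exp (-(Δ ^ 2 / (16 * k))) := by
  have hn0 : (0 : ℝ) < n := by exact_mod_cast i.pos
  set p : ℝ := (k - Δ) / n with hp
  have hp0 : 0 ≤ p := div_nonneg (by linarith) hn0.le
  have hnp : n * p = k - Δ := by rw [hp]; field_simp
  set t : ℝ := Δ / (4 * k)
  have ht0 : 0 ≤ t := by positivity
  set S : Set (M × M) := {q | reachMass ν q ≤ p}
  have hSm : MeasurableSet S := measurableSet_le (measurable_reachMass ν) measurable_const
  have key := measureReal_pi_le_mul_ncard_ne_le_exp ν i hSm (s := t) (a := t * (k - 1))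
    fun c => mul_le_mul_of_nonneg_right (measureReal_setOf_reachMass_le ν c hp0)
      (sub_nonneg.2 (Real.one_le_exp ht0))
  refine (measureReal_mono ?_).trans (key.trans (Real.exp_le_exp.2 ?_))
  · rintro x ⟨r, hr, hc⟩
    have hsub : {j | dist (x j) (x i) ≤ r} ⊆ insert i {j | j ≠ i ∧ (x i, x j) ∈ S} := by
      intro j hj
      refine (eq_or_ne j i).imp id fun hji => ⟨hji, ?_⟩
      exact (measureReal_mono (Metric.closedBall_subset_closedBall hj)).trans hr
    have hcount := hc.trans ((Set.ncard_le_ncard hsub).trans (Set.ncard_insert_le _ _))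
    have : (k : ℝ) ≤ ({j | j ≠ i ∧ (x i, x j) ∈ S}.ncard : ℝ) + 1 := by exact_mod_cast hcount
    exact mul_le_mul_of_nonneg_left (by linarith) ht0
  · have := upperTail_exponent_le (w := (n - 1) * p) hΔ hΔk (by linarith)
    linarith

end Counts

/-! ### Half-balls -/

section HalfBall

variable {E : Type*} [NormedAddCommGroup E] [InnerProductSpace ℝ E]

/-- The half of the closed ball of radius `ρ` around `a` that faces `b`. -/
def halfBall (a b : E) (ρ : ℝ) : Set E :=
  {z | dist z a ≤ ρ ∧ 0 ≤ inner ℝ (z - a) (b - a)}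

theorem dist_sq_le_of_mem_halfBall {a b z : E} {ρ : ℝ} (hz : z ∈ halfBall a b ρ) :
    dist z b ^ 2 ≤ dist z a ^ 2 + dist a b ^ 2 := by
  have h := norm_sub_sq_real (z - a) (b - a)
  rw [sub_sub_sub_cancel_right] at h
  rw [dist_eq_norm, dist_eq_norm, dist_comm a b, dist_eq_norm, h]
  linarith [hz.2]

/-- The centres `a`, `b` stand for points of a finite net close to `y`, `x`, whence the slack. -/
theorem dist_le_of_mem_halfBall {θ s ρ : ℝ} (hθ : 0 < θ) (hθ1 : θ ≤ 1) (hs : 0 < s)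
    {x y a b z : E} (hxy : dist x y ≤ s) (hya : dist y a ≤ θ / 64 * s)
    (hxb : dist x b ≤ θ / 64 * s) (hρ : ρ ≤ (1 - θ / 8) * s) (hz : z ∈ halfBall a b ρ) :
    dist z y ≤ s ∧ dist z x ≤ √2 * s := by
  have hθs : 0 < θ * s := mul_pos hθ hs
  have hza : dist z a ≤ (1 - θ / 8) * s := hz.1.trans hρ
  have hab : dist a b ≤ (1 + θ / 32) * s := by
    have := dist_triangle4 a y x b
    rw [dist_comm a y, dist_comm y x] at this
    linarith
  constructor
  · have := dist_triangle_right z y a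
    linarith
  · have hsqrt : (√2) ^ 2 = 2 := Real.sq_sqrt (by norm_num)
    have hsqrt1 : 1 ≤ √2 := Real.one_le_sqrt.2 (by norm_num)
    have hsqrt2 : √2 ≤ 1.5 := by rw [Real.sqrt_le_left (by norm_num)]; norm_num
    have hzb : dist z b ≤ (√2 - θ / 64) * s := by
      refine le_of_sq_le_sq ?_ (mul_nonneg (by linarith) hs.le)
      calc dist z b ^ 2 ≤ dist z a ^ 2 + dist a b ^ 2 := dist_sq_le_of_mem_halfBall hz
        _ ≤ ((1 - θ / 8) * s) ^ 2 + ((1 + θ / 32) * s) ^ 2 := by gcongr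
        _ = ((1 - θ / 8) ^ 2 + (1 + θ / 32) ^ 2) * s ^ 2 := by ring
        _ ≤ (√2 - θ / 64) ^ 2 * s ^ 2 := by gcongr; nlinarith
        _ = ((√2 - θ / 64) * s) ^ 2 := by ring
    have := dist_triangle_right z x b
    linarith

variable [MeasurableSpace E] [BorelSpace E]

theorem measurableSet_halfBall (a b : E) (ρ : ℝ) : MeasurableSet (halfBall a b ρ) := by
  have hball : IsClosed {z : E | dist z a ≤ ρ} := isClosed_le (by fun_prop) (by fun_prop)
  have hhalf : IsClosed {z : E | 0 ≤ inner ℝ (z - a) (b - a)} :=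
    isClosed_le (by fun_prop) (by fun_prop)
  exact (hball.inter hhalf).measurableSet

theorem measure_closedBall_le_two_mul_measure_halfBall (μ : Measure E) [μ.IsNegInvariant]
    [μ.IsAddLeftInvariant] (a b : E) (ρ : ℝ) :
    μ (Metric.closedBall a ρ) ≤ 2 * μ (halfBall a b ρ) := by
  have hreflect : MeasurePreserving (fun z => (a + a) - z) μ μ :=
    Measure.measurePreserving_sub_left μ (a + a)
  have hsub : Metric.closedBall a ρ ⊆
      halfBall a b ρ ∪ (fun z => (a + a) - z) ⁻¹' halfBall a b ρ := by
    intro z hz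
    have hza : (a + a) - z - a = -(z - a) := by abel
    refine (le_total 0 (inner ℝ (z - a) (b - a))).imp (fun h => ⟨hz, h⟩) fun h => ⟨?_, ?_⟩
    · rwa [dist_eq_norm, hza, norm_neg, ← dist_eq_norm]
    · rw [hza, inner_neg_left]
      linarith
  calc μ (Metric.closedBall a ρ)
      ≤ μ (halfBall a b ρ) + μ ((fun z => (a + a) - z) ⁻¹' halfBall a b ρ) :=
        (measure_mono hsub).trans (measure_union_le _ _)
    _ = 2 * μ (halfBall a b ρ) := by
        rw [hreflect.measure_preimage (measurableSet_halfBall a b ρ).nullMeasurableSet, two_mul]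

end HalfBall

/-! ### Volume and mass -/

theorem unitBallVolume_pos (d : ℕ) : 0 < unitBallVolume d :=
  ENNReal.toReal_pos (Metric.measure_closedBall_pos volume _ one_pos).ne'
    measure_closedBall_lt_top.ne

theorem volumeReal_closedBall {d : ℕ} (c : Space d) {r : ℝ} (hr : 0 ≤ r) :
    volume.real (Metric.closedBall c r) = unitBallVolume d * r ^ d := by
  rw [Measure.addHaar_real_closedBall' _ _ hr, finrank_euclideanSpace_fin, mul_comm]
  rfl

theorem volumeReal_halfBall_ge {d : ℕ} (a b : Space d) {ρ : ℝ} (hρ : 0 ≤ ρ) :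
    unitBallVolume d * ρ ^ d / 2 ≤ volume.real (halfBall a b ρ) := by
  have hfin : volume (halfBall a b ρ) ≠ ⊤ :=
    measure_ne_top_of_subset (fun _ hz => hz.1) (measure_closedBall_lt_top (x := a) (r := ρ)).ne
  have h := ENNReal.toReal_mono (by finiteness)
    (measure_closedBall_le_two_mul_measure_halfBall volume a b ρ)
  rw [← measureReal_def, volumeReal_closedBall a hρ, ENNReal.toReal_mul, ENNReal.toReal_ofNat,
    ← measureReal_def] at h
  linarith

theorem measure_sphere_eq_zero {d : ℕ} (hd : 1 ≤ d) (f : Space d → ℝ) (c : Space d) (r : ℝ) :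
    densityMeasure f (Metric.sphere c r) = 0 :=
  have : Nonempty (Fin d) := ⟨⟨0, hd⟩⟩
  withDensity_absolutelyContinuous _ _ (Measure.addHaar_sphere volume c r)

theorem densityMeasure_real_closedBall_le {d : ℕ} {f : Space d → ℝ} {c : Space d} {r u : ℝ}
    (hr : 0 ≤ r) (hu : ∀ z ∈ Metric.closedBall c r, f z ≤ u) (hu0 : 0 ≤ u) :
    (densityMeasure f).real (Metric.closedBall c r) ≤ u * (unitBallVolume d * r ^ d) := by
  rw [← volumeReal_closedBall c hr, measureReal_def, measureReal_def,
    ← ENNReal.toReal_ofReal hu0, ← ENNReal.toReal_mul]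
  refine ENNReal.toReal_mono
    (ENNReal.mul_ne_top ENNReal.ofReal_ne_top measure_closedBall_lt_top.ne) ?_
  rw [densityMeasure, withDensity_apply _ Metric.isClosed_closedBall.measurableSet,
    ← setLIntegral_const]
  exact setLIntegral_mono' Metric.isClosed_closedBall.measurableSet fun z hz =>
    ENNReal.ofReal_le_ofReal (hu z hz)

namespace IsDensityOn

variable {d : ℕ} {X : Set (Space d)} {f : Space d → ℝ}

theorem isProbabilityMeasure (hf : IsDensityOn X f) : IsProbabilityMeasure (densityMeasure f) :=
  ⟨by rw [densityMeasure, withDensity_apply _ MeasurableSet.univ, Measure.restrict_univ,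
    hf.lintegral_eq_one]⟩

theorem isProbabilityMeasure_sampleMeasure (hf : IsDensityOn X f) (n : ℕ) :
    IsProbabilityMeasure (sampleMeasure f n) :=
  have := hf.isProbabilityMeasure
  inferInstanceAs (IsProbabilityMeasure (Measure.pi _))

theorem ae_mem (hf : IsDensityOn X f) : ∀ᵐ y ∂densityMeasure f, y ∈ X := by
  refine (ae_withDensity_iff hf.measurable.ennreal_ofReal).2 (ae_of_all _ fun y hy => ?_)
  by_contra hyX
  exact hy (by rw [hf.eq_zero_of_notMem y hyX, ENNReal.ofReal_zero])

theorem ae_forall_mem (hf : IsDensityOn X f) (n : ℕ) :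
    ∀ᵐ x ∂sampleMeasure f n, ∀ i, x i ∈ X :=
  have := hf.isProbabilityMeasure
  ae_all_iff.2 fun _ => Measure.tendsto_eval_ae_ae.eventually hf.ae_mem

theorem mul_volumeReal_le (hf : IsDensityOn X f) {H : Set (Space d)} (hH : MeasurableSet H)
    {l : ℝ} (hl : ∀ z ∈ H, l ≤ f z) (hl0 : 0 ≤ l) :
    l * volume.real H ≤ (densityMeasure f).real H := by
  have := hf.isProbabilityMeasure
  rw [measureReal_def, measureReal_def, ← ENNReal.toReal_ofReal hl0, ← ENNReal.toReal_mul]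
  refine ENNReal.toReal_mono (measure_ne_top _ _) ?_
  rw [densityMeasure, withDensity_apply _ hH, ← setLIntegral_const]
  exact setLIntegral_mono' hH fun z hz => ENNReal.ofReal_le_ofReal (hl z hz)

theorem volume_regionBetween_eq_one (hf : IsDensityOn X f) :
    (volume : Measure (Space d)).prod volume (regionBetween 0 f Set.univ) = 1 := by
  rw [volume_regionBetween_eq_lintegral' measurable_zero hf.measurable MeasurableSet.univ]
  simp [hf.lintegral_eq_one]

end IsDensityOn

/-! ### A finite net of half-balls -/

theorem exists_finset_inter_nonempty {ι γ : Type*} [MeasurableSpace γ] (μ : Measure γ)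
    {B : ι → Set γ} {t : Set ι} {A : Set γ} {b : ℝ≥0∞} (hB : ∀ a ∈ t, MeasurableSet (B a))
    (hBA : ∀ a ∈ t, B a ⊆ A) (hA : μ A ≠ ⊤) (hb : 0 < b) (hbB : ∀ a ∈ t, b ≤ μ (B a)) :
    ∃ F : Finset ι, ↑F ⊆ t ∧ F.card * b ≤ μ A ∧ ∀ a ∈ t, ∃ u ∈ F, (B a ∩ B u).Nonempty := by
  obtain ⟨u, hut, hdisj, hmeet⟩ := Vitali.exists_disjoint_subfamily_covering_enlargement B t
    (fun _ => 0) 2 one_lt_two (fun _ _ => le_rfl) 0 (fun _ _ => le_rfl)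
    fun a ha => nonempty_of_measure_ne_zero (hb.trans_le (hbB a ha)).ne'
  have hunion : (⋃ i : u, B i) ⊆ A := Set.iUnion_subset fun i => hBA i (hut i.2)
  have hfin := Measure.finite_const_le_meas_of_disjoint_iUnion μ hb (As := fun i : u => B i)
    (fun i => hB i (hut i.2)) (hdisj.subtype _ _) (measure_ne_top_of_subset hunion hA)
  have hu : u.Finite := Set.finite_coe_iff.1 <| Set.finite_univ_iff.1 <|
    hfin.subset fun i _ => hbB i (hut i.2)
  lift u to Finset ι using hu
  refine ⟨u, hut, ?_, fun a ha => (hmeet a ha).imp fun _ h => ⟨h.1, h.2.1⟩⟩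
  calc u.card * b = ∑ _i ∈ u, b := by rw [Finset.sum_const, nsmul_eq_mul]
    _ ≤ ∑ i ∈ u, μ (B i) := Finset.sum_le_sum fun i hi => hbB i (hut hi)
    _ = μ (⋃ i ∈ u, B i) := (measure_biUnion_finset hdisj fun i hi => hB i (hut hi)).symm
    _ ≤ μ A := measure_mono (Set.iUnion₂_subset fun i hi => hBA i (hut hi))

/-- A box below the graph of any density that is at least `q / (v_d r ^ d)` around `c`, where
`u = (c, r)`. Its height is chosen such that the boxes of `(c, r)` and `(c', r')` can only meet if
`r` and `r'` agree up to a factor `1 - 1 / (16 d)`. -/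
def densityBox (d : ℕ) (q : ℝ) (u : Space d × ℝ) : Set (Space d × ℝ) :=
  Metric.closedBall u.1 ((d : ℝ)⁻¹ / 200 * u.2) ×ˢ
    Set.Ioo ((1 - (d : ℝ)⁻¹ / 16) ^ d * (q / (unitBallVolume d * u.2 ^ d)))
      (q / (unitBallVolume d * u.2 ^ d))

section Net

variable {d : ℕ} {q : ℝ}

theorem one_sub_inv_div_pow_le (hd : 1 ≤ d) : (1 - (d : ℝ)⁻¹ / 16) ^ d ≤ 16 / 17 := by
  have hd1 : (1 : ℝ) ≤ d := by exact_mod_cast hd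
  have h := Real.one_sub_div_pow_le_exp_neg (n := d) (t := 1 / 16) (by linarith)
  rw [show (1 : ℝ) / 16 / d = (d : ℝ)⁻¹ / 16 by ring, Real.exp_neg] at h
  refine h.trans (inv_le_of_inv_le₀ (by norm_num) ?_)
  linarith [Real.add_one_le_exp (1 / 16 : ℝ)]

theorem ofReal_le_volume_densityBox (hd : 1 ≤ d) (hq : 0 < q) {u : Space d × ℝ} (hu : 0 < u.2) :
    ENNReal.ofReal (q / (17 * (200 * d) ^ d)) ≤
      (volume : Measure (Space d)).prod volume (densityBox d q u) := by
  have : (1 : ℝ) ≤ d := by exact_mod_cast hd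
  have hv := unitBallVolume_pos d
  rw [densityBox, Measure.prod_prod, Real.volume_Ioo,
    ← ofReal_measureReal measure_closedBall_lt_top.ne, volumeReal_closedBall _ (by positivity),
    ← ENNReal.ofReal_mul (by positivity)]
  refine ENNReal.ofReal_le_ofReal ?_
  calc q / (17 * (200 * d : ℝ) ^ d) = q / (200 * d) ^ d * (1 - 16 / 17) := by field_simp; norm_num
    _ ≤ q / (200 * d) ^ d * (1 - (1 - (d : ℝ)⁻¹ / 16) ^ d) := by
        gcongr
        exact one_sub_inv_div_pow_le hd
    _ = _ := by
        rw [show (d : ℝ)⁻¹ / 200 * u.2 = u.2 / (200 * d) by ring, div_pow]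
        field_simp

theorem mul_le_of_mul_div_lt_div {c C q a b : ℝ} (hc : 0 < c) (hq : 0 < q) (ha : 0 < a)
    (hb : 0 < b) (h : C ^ d * (q / (c * a ^ d)) < q / (c * b ^ d)) : C * b ≤ a := by
  rw [← mul_div_assoc, div_lt_div_iff₀ (by positivity) (by positivity)] at h
  refine (lt_of_pow_lt_pow_left₀ d ha.le ?_).le
  rw [mul_pow]
  exact lt_of_mul_lt_mul_left (a := q * c) (by linarith) (by positivity)

theorem comparable_of_densityBox_inter_nonempty (hq : 0 < q) {u w : Space d × ℝ}
    (hu : 0 < u.2) (hw : 0 < w.2) (h : (densityBox d q u ∩ densityBox d q w).Nonempty) :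
    dist u.1 w.1 ≤ (d : ℝ)⁻¹ / 200 * (u.2 + w.2) ∧ (1 - (d : ℝ)⁻¹ / 16) * u.2 ≤ w.2 ∧
      (1 - (d : ℝ)⁻¹ / 16) * w.2 ≤ u.2 := by
  obtain ⟨⟨z, t⟩, ⟨hzu, htu, htu'⟩, ⟨hzw, htw, htw'⟩⟩ := h
  have hv := unitBallVolume_pos d
  refine ⟨?_, mul_le_of_mul_div_lt_div hv hq hw hu (htw.trans htu'),
    mul_le_of_mul_div_lt_div hv hq hu hw (htu.trans htw')⟩
  have h₁ := Metric.mem_closedBall.1 hzu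
  have h₂ := Metric.mem_closedBall.1 hzw
  rw [mul_add]
  exact (dist_triangle_left _ _ _).trans (add_le_add h₁ h₂)

theorem densityBox_subset_regionBetween (hq : 0 < q) {f : Space d → ℝ}
    {u : Space d × ℝ} (hu : 0 < u.2)
    (hfu : ∀ z ∈ Metric.closedBall u.1 u.2, q / (unitBallVolume d * u.2 ^ d) ≤ f z) :
    densityBox d q u ⊆ regionBetween 0 f Set.univ := by
  have hθ1 : (d : ℝ)⁻¹ ≤ 1 := Nat.cast_inv_le_one d
  have hv := unitBallVolume_pos d
  rintro ⟨z, t⟩ ⟨hz, ht, ht'⟩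
  have hzu : z ∈ Metric.closedBall u.1 u.2 :=
    Metric.closedBall_subset_closedBall (by nlinarith) hz
  have h0 : (0 : ℝ) ≤ 1 - (d : ℝ)⁻¹ / 16 := by linarith
  exact ⟨trivial, lt_of_le_of_lt (by simp only [Pi.zero_apply]; positivity) ht,
    ht'.trans_le (hfu z hzu)⟩

theorem net_scale_bounds {θ s t : ℝ} (hθ : 0 < θ) (hθ1 : θ ≤ 1) (hs : 0 < s)
    (hst : (1 - θ / 16) * s ≤ t) (hts : (1 - θ / 16) * t ≤ s) :
    θ / 200 * (s + t) ≤ θ / 64 * s ∧ (1 - θ / 2) * s ≤ (1 - θ / 4) * t ∧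
      (1 - θ / 4) * t ≤ (1 - θ / 8) * s := by
  have hts' : t ≤ (1 + θ / 8) * s := by
    have h1 : s ≤ (1 - θ / 16) * ((1 + θ / 8) * s) := by nlinarith [mul_pos hθ hs]
    exact le_of_mul_le_mul_left (hts.trans h1) (by linarith)
  refine ⟨?_, ?_, ?_⟩
  · nlinarith [mul_pos hθ hs]
  · calc (1 - θ / 2) * s ≤ (1 - θ / 4) * ((1 - θ / 16) * s) := by nlinarith [mul_pos hθ hs]
      _ ≤ (1 - θ / 4) * t := by gcongr; linarith
  · calc (1 - θ / 4) * t ≤ (1 - θ / 4) * ((1 + θ / 8) * s) := by gcongr; linarith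
      _ ≤ (1 - θ / 8) * s := by nlinarith [mul_pos hθ hs]

namespace IsDensityOn

variable {X : Set (Space d)} {f : Space d → ℝ}

theorem exists_finset_net (hd : 1 ≤ d) (hf : IsDensityOn X f) (hq : 0 < q) :
    ∃ F : Finset (Space d × ℝ), (F.card : ℝ) ≤ 17 * (200 * d) ^ d / q ∧
      ∀ (y : Space d) (s : ℝ), 0 < s →
        (∀ z ∈ Metric.closedBall y s, q / (unitBallVolume d * s ^ d) ≤ f z) →
        ∃ u ∈ F, dist y u.1 ≤ (d : ℝ)⁻¹ / 64 * s ∧ (1 - (d : ℝ)⁻¹ / 2) * s ≤ u.2 ∧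
          u.2 ≤ (1 - (d : ℝ)⁻¹ / 8) * s := by
  classical
  have : (1 : ℝ) ≤ d := by exact_mod_cast hd
  have hb : 0 < q / (17 * (200 * d : ℝ) ^ d) := by positivity
  obtain ⟨F, hFt, hcard, hmeet⟩ := exists_finset_inter_nonempty
    ((volume : Measure (Space d)).prod volume) (B := densityBox d q)
    (t := {u | 0 < u.2 ∧
      ∀ z ∈ Metric.closedBall u.1 u.2, q / (unitBallVolume d * u.2 ^ d) ≤ f z})
    (A := regionBetween 0 f Set.univ) (b := ENNReal.ofReal (q / (17 * (200 * d : ℝ) ^ d)))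
    (fun _ _ => Metric.isClosed_closedBall.measurableSet.prod measurableSet_Ioo)
    (fun _ hu => densityBox_subset_regionBetween hq hu.1 hu.2)
    (by rw [hf.volume_regionBetween_eq_one]; exact ENNReal.one_ne_top)
    (ENNReal.ofReal_pos.2 hb) fun _ hu => ofReal_le_volume_densityBox hd hq hu.1
  refine ⟨F.image fun u => (u.1, (1 - (d : ℝ)⁻¹ / 4) * u.2), ?_, fun y s hs hy => ?_⟩
  · rw [hf.volume_regionBetween_eq_one, ← ENNReal.ofReal_natCast,
      ← ENNReal.ofReal_mul (Nat.cast_nonneg _), ENNReal.ofReal_le_one, ← le_div_iff₀ hb,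
      one_div_div] at hcard
    exact (Nat.cast_le.2 Finset.card_image_le).trans hcard
  · obtain ⟨u, huF, hu⟩ := hmeet (y, s) ⟨hs, hy⟩
    obtain ⟨hdist, hsu, hus⟩ :=
      comparable_of_densityBox_inter_nonempty hq hs (hFt huF).1 hu
    obtain ⟨h₁, h₂, h₃⟩ :=
      net_scale_bounds (by positivity) (Nat.cast_inv_le_one d) hs hsu hus
    exact ⟨_, Finset.mem_image_of_mem _ huF, hdist.trans h₁, h₂, h₃⟩

theorem le_measureReal_halfBall (hd : 1 ≤ d) (hf : IsDensityOn X f) (hq : 0 ≤ q) {s ρ : ℝ}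
    (hs : 0 < s) (hρ : (1 - (d : ℝ)⁻¹ / 2) * s ≤ ρ) {a b : Space d}
    (hab : ∀ z ∈ halfBall a b ρ, q / (unitBallVolume d * s ^ d) ≤ f z) :
    q / 4 ≤ (densityMeasure f).real (halfBall a b ρ) := by
  have : (1 : ℝ) ≤ d := by exact_mod_cast hd
  have hθ1 : (d : ℝ)⁻¹ ≤ 1 := Nat.cast_inv_le_one d
  have hv := unitBallVolume_pos d
  have hρ0 : 0 ≤ ρ := (mul_nonneg (by linarith) hs.le).trans hρ
  have hbernoulli : 1 / 2 ≤ (1 - (d : ℝ)⁻¹ / 2) ^ d := by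
    refine le_trans (le_of_eq ?_)
      (one_add_mul_sub_le_pow (a := 1 - (d : ℝ)⁻¹ / 2) (by linarith) d)
    field_simp
    norm_num
  have hpow : s ^ d / 2 ≤ ρ ^ d :=
    calc s ^ d / 2 = 1 / 2 * s ^ d := by ring
      _ ≤ (1 - (d : ℝ)⁻¹ / 2) ^ d * s ^ d := by gcongr
      _ = ((1 - (d : ℝ)⁻¹ / 2) * s) ^ d := (mul_pow ..).symm
      _ ≤ ρ ^ d := pow_le_pow_left₀ (mul_nonneg (by linarith) hs.le) hρ d
  calc q / 4 = q / (unitBallVolume d * s ^ d) * (unitBallVolume d * (s ^ d / 2) / 2) := by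
        field_simp; norm_num
    _ ≤ q / (unitBallVolume d * s ^ d) * (unitBallVolume d * ρ ^ d / 2) := by gcongr
    _ ≤ q / (unitBallVolume d * s ^ d) * volume.real (halfBall a b ρ) := by
        gcongr; exact volumeReal_halfBall_ge a b hρ0
    _ ≤ _ := hf.mul_volumeReal_le (measurableSet_halfBall a b ρ) hab (by positivity)

theorem exists_finset_halfBall_net (hd : 1 ≤ d) (hf : IsDensityOn X f) (hq : 0 < q) :
    ∃ G : Finset ((Space d × ℝ) × (Space d × ℝ)),
      (G.card : ℝ) ≤ (17 * (200 * d) ^ d / q) ^ 2 ∧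
      (∀ p ∈ G, q / 4 ≤ (densityMeasure f).real (halfBall p.1.1 p.2.1 p.1.2)) ∧
      ∀ s, 0 < s → ∀ y b, dist b y ≤ s →
        (∀ z ∈ Metric.closedBall y (2 * s), q / (unitBallVolume d * s ^ d) ≤ f z) →
        ∃ p ∈ G, ∀ z ∈ halfBall p.1.1 p.2.1 p.1.2, dist z y ≤ s ∧ dist z b ≤ √2 * s := by
  classical
  have hθ : (0 : ℝ) < (d : ℝ)⁻¹ := by have : (1 : ℝ) ≤ d := (by exact_mod_cast hd); positivity
  have hθ1 : (d : ℝ)⁻¹ ≤ 1 := Nat.cast_inv_le_one d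
  obtain ⟨F, hcard, hF⟩ := hf.exists_finset_net hd hq
  refine ⟨{p ∈ F ×ˢ F | q / 4 ≤ (densityMeasure f).real (halfBall p.1.1 p.2.1 p.1.2)}, ?_,
    fun p hp => (Finset.mem_filter.1 hp).2, fun s hs y b hby hfy => ?_⟩
  · calc _ ≤ ((F ×ˢ F).card : ℝ) := Nat.cast_le.2 (Finset.card_filter_le _ _)
      _ = (F.card : ℝ) ^ 2 := by rw [Finset.card_product, Nat.cast_mul, sq]
      _ ≤ (17 * (200 * d) ^ d / q) ^ 2 := by gcongr
  · have hdense : ∀ c, dist c y ≤ s →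
        ∀ z ∈ Metric.closedBall c s, q / (unitBallVolume d * s ^ d) ≤ f z := fun c hc z hz =>
      hfy z (Metric.closedBall_subset_closedBall' (by linarith) hz)
    obtain ⟨u, hu, hyu, hsu, hus⟩ := hF y s hs (hdense y (by rw [dist_self]; exact hs.le))
    obtain ⟨w, hw, hbw, -, -⟩ := hF b s hs (hdense b hby)
    have hnear : ∀ z ∈ halfBall u.1 w.1 u.2, dist z y ≤ s ∧ dist z b ≤ √2 * s := fun z =>
      dist_le_of_mem_halfBall hθ hθ1 hs hby hyu hbw hus
    refine ⟨(u, w), Finset.mem_filter.2 ⟨Finset.mk_mem_product hu hw, ?_⟩, hnear⟩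
    refine hf.le_measureReal_halfBall hd hq.le hs hsu fun z hz => hfy z ?_
    exact Metric.mem_closedBall.2 ((hnear z hz).1.trans (by linarith))

end IsDensityOn

end Net

/-! ### Samples hitting all heavy half-balls -/

/-- Wherever the density is at least `q / (v_d s ^ d)`, the sample meets the half-balls of radius
`s`, in the form in which this is used: around `y` there is a data point in direction `b`. -/
def HitsHalfBalls {d n : ℕ} (f : Space d → ℝ) (q : ℝ) (x : Fin n → Space d) : Prop :=
  ∀ s : ℝ, 0 < s → ∀ y b : Space d, dist b y ≤ s →
    (∀ z ∈ Metric.closedBall y (2 * s), q / (unitBallVolume d * s ^ d) ≤ f z) →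
    ∃ j, dist (x j) y ≤ s ∧ dist (x j) b ≤ √2 * s

theorem measureReal_pi_forall_notMem_le {Ω ι : Type*} [MeasurableSpace Ω] [Fintype ι]
    (ν : Measure Ω) [IsProbabilityMeasure ν] {H : Set Ω} (hH : MeasurableSet H) {p : ℝ}
    (hp : p ≤ ν.real H) :
    (Measure.pi fun _ : ι => ν).real {x | ∀ j, x j ∉ H} ≤ Real.exp (-(Fintype.card ι * p)) := by
  have hpi : {x : ι → Ω | ∀ j, x j ∉ H} = Set.univ.pi fun _ => Hᶜ := by
    ext x
    simp
  have h1 : 0 ≤ 1 - ν.real H := sub_nonneg.2 measureReal_le_one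
  calc (Measure.pi fun _ : ι => ν).real {x | ∀ j, x j ∉ H}
      = (1 - ν.real H) ^ Fintype.card ι := by
        rw [hpi, measureReal_def, Measure.pi_pi, Finset.prod_const, ENNReal.toReal_pow,
          ← measureReal_def, probReal_compl_eq_one_sub hH, Finset.card_univ]
    _ ≤ Real.exp (-p) ^ Fintype.card ι := by
        gcongr
        linarith [Real.add_one_le_exp (-p)]
    _ = Real.exp (-(Fintype.card ι * p)) := by rw [← Real.exp_nat_mul, mul_neg]

theorem IsDensityOn.measureReal_not_hitsHalfBalls_le {d : ℕ} {X : Set (Space d)}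
    {f : Space d → ℝ} {q : ℝ} (hd : 1 ≤ d) (hf : IsDensityOn X f) (hq : 0 < q) (n : ℕ) :
    (sampleMeasure f n).real {x | ¬ HitsHalfBalls f q x} ≤
      (17 * (200 * d) ^ d / q) ^ 2 * Real.exp (-(n * (q / 4))) := by
  have := hf.isProbabilityMeasure
  have := hf.isProbabilityMeasure_sampleMeasure n
  obtain ⟨G, hcard, hmass, hG⟩ := hf.exists_finset_halfBall_net hd hq
  set H : (Space d × ℝ) × (Space d × ℝ) → Set (Space d) :=
    fun p => halfBall p.1.1 p.2.1 p.1.2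
  have hsub : {x : Fin n → Space d | ¬ HitsHalfBalls f q x} ⊆
      ⋃ p ∈ G, {x | ∀ j, x j ∉ H p} := by
    intro x hx
    simp only [HitsHalfBalls, Set.mem_ofPred_eq] at hx
    push Not at hx
    obtain ⟨s, hs, y, b, hby, hfy, hmiss⟩ := hx
    obtain ⟨p, hp, hpH⟩ := hG s hs y b hby hfy
    exact Set.mem_iUnion₂.2 ⟨p, hp, fun j hj =>
      (hmiss j (hpH _ hj).1).not_ge (hpH _ hj).2⟩
  calc (sampleMeasure f n).real {x | ¬ HitsHalfBalls f q x}
      ≤ (sampleMeasure f n).real (⋃ p ∈ G, {x | ∀ j, x j ∉ H p}) :=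
        measureReal_mono hsub (measure_ne_top _ _)
    _ ≤ ∑ p ∈ G, (sampleMeasure f n).real {x | ∀ j, x j ∉ H p} :=
        measureReal_biUnion_finset_le _ _
    _ ≤ ∑ _p ∈ G, Real.exp (-(n * (q / 4))) := Finset.sum_le_sum fun p hp => by
        simpa only [Fintype.card_fin, sampleMeasure] using
          measureReal_pi_forall_notMem_le (ι := Fin n) _ (measurableSet_halfBall ..) (hmass p hp)
    _ = G.card * Real.exp (-(n * (q / 4))) := by rw [Finset.sum_const, nsmul_eq_mul]
    _ ≤ (17 * (200 * d) ^ d / q) ^ 2 * Real.exp (-(n * (q / 4))) := by gcongr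

/-! ### Typical samples -/

/-- The properties of a sample from which the guarantees follow: its points lie in `X`, balls around
them contain `k` data points or fail to if their mass exceeds or falls short of `k / n` by `e`, and
half-balls of mass `q` are hit. -/
structure IsTypicalSample {d n : ℕ} (X : Set (Space d)) (f : Space d → ℝ) (k : ℕ) (e q : ℝ)
    (x : Fin n → Space d) : Prop where
  mem : ∀ i, x i ∈ X
  le_ncard : ∀ i r, k / n + e ≤ (densityMeasure f).real (Metric.closedBall (x i) r) →
    k ≤ {j | dist (x j) (x i) ≤ r}.ncard
  ncard_lt : ∀ i r, (densityMeasure f).real (Metric.closedBall (x i) r) ≤ k / n - e →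
    {j | dist (x j) (x i) ≤ r}.ncard < k
  hitsHalfBalls : HitsHalfBalls f q x

theorem measureReal_setOf_exists_fin_le {Ω : Type*} [MeasurableSpace Ω] (μ : Measure Ω) {n : ℕ}
    {p : Fin n → Ω → Prop} {b : ℝ} (hb : ∀ i, μ.real {ω | p i ω} ≤ b) :
    μ.real {ω | ∃ i, p i ω} ≤ n * b := by
  rw [Set.ofPred_exists]
  refine (measureReal_iUnion_fintype_le _).trans ((Finset.sum_le_sum fun i _ => hb i).trans_eq ?_)
  rw [Finset.sum_const, Finset.card_univ, Fintype.card_fin, nsmul_eq_mul]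

theorem IsDensityOn.measureReal_not_isTypicalSample_le {d n k : ℕ} {X : Set (Space d)}
    {f : Space d → ℝ} {Δ q : ℝ} (hd : 1 ≤ d) (hf : IsDensityOn X f) (hk : 1 ≤ k) (hΔ : 2 ≤ Δ)
    (hΔk : Δ ≤ k) (hq : 0 < q) :
    (sampleMeasure f n).real {x | ¬ IsTypicalSample X f k (Δ / n) q x} ≤
      n * Real.exp (-(Δ ^ 2 / (8 * k))) + n * Real.exp (-(Δ ^ 2 / (16 * k))) +
        (17 * (200 * d) ^ d / q) ^ 2 * Real.exp (-(n * (q / 4))) := by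
  have := hf.isProbabilityMeasure
  have := hf.isProbabilityMeasure_sampleMeasure n
  set μ := sampleMeasure f n
  set few : Set (Fin n → Space d) := {x | ∃ i, ∃ r : ℝ, (k + Δ) / n ≤
    (densityMeasure f).real (Metric.closedBall (x i) r) ∧ {j | dist (x j) (x i) ≤ r}.ncard < k}
  set many : Set (Fin n → Space d) := {x | ∃ i, ∃ r : ℝ,
    (densityMeasure f).real (Metric.closedBall (x i) r) ≤ (k - Δ) / n ∧
      k ≤ {j | dist (x j) (x i) ≤ r}.ncard}
  set miss : Set (Fin n → Space d) := {x | ¬ HitsHalfBalls f q x}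
  set outside : Set (Fin n → Space d) := {x | ¬ ∀ i, x i ∈ X}
  have hsub : {x | ¬ IsTypicalSample X f k (Δ / n) q x} ⊆ few ∪ many ∪ miss ∪ outside := by
    intro x hx
    by_contra hcon
    simp only [Set.mem_union, not_or] at hcon
    obtain ⟨⟨⟨hfew, hmany⟩, hmiss⟩, hout⟩ := hcon
    refine hx ⟨not_not.1 hout, fun i r hr => ?_, fun i r hr => ?_, not_not.1 hmiss⟩
    · rw [← add_div] at hr
      exact not_lt.1 fun h => hfew ⟨i, r, hr, h⟩
    · rw [← sub_div] at hr
      exact not_le.1 fun h => hmany ⟨i, r, hr, h⟩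
  have hfew : μ.real few ≤ n * Real.exp (-(Δ ^ 2 / (8 * k))) :=
    measureReal_setOf_exists_fin_le μ fun i => measureReal_exists_heavy_ball_ncard_lt_le _
      (measure_sphere_eq_zero hd f) hk (by linarith) hΔk i
  have hmany : μ.real many ≤ n * Real.exp (-(Δ ^ 2 / (16 * k))) :=
    measureReal_setOf_exists_fin_le μ fun i =>
      measureReal_exists_light_ball_le_ncard_le _ hΔ hΔk i
  have hmiss := hf.measureReal_not_hitsHalfBalls_le hd hq n
  have hout : μ.real outside = 0 := by
    rw [measureReal_def, ae_iff.1 (hf.ae_forall_mem n), ENNReal.toReal_zero]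
  calc μ.real {x | ¬ IsTypicalSample X f k (Δ / n) q x}
      ≤ μ.real few + μ.real many + μ.real miss + μ.real outside :=
        (measureReal_mono hsub).trans <| (measureReal_union_le _ _).trans <|
          add_le_add_left ((measureReal_union_le _ _).trans <|
            add_le_add_left (measureReal_union_le _ _) _) _
    _ ≤ _ := by rw [hout, add_zero]; gcongr

/-! ### Choice of the constants -/

/-- The mass from which on all relevant half-balls contain data points. -/
def hitMass (d n : ℕ) (δ : ℝ) : ℝ := 400 * (d * Real.log n * Real.log (2 / δ)) / n

section Numerics

variable {d n k : ℕ} {δ ε : ℝ}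

theorem lt_log_two_div (hδ : 0 < δ) (hδ1 : δ < 1) : 0.69 < Real.log (2 / δ) := by
  have h2 : (2 : ℝ) < 2 / δ := by rw [lt_div_iff₀ hδ]; linarith
  linarith [Real.log_two_gt_d9, Real.log_lt_log two_pos h2]

theorem log_le_natCast_mul_log (hd : 1 ≤ d) : Real.log n ≤ d * Real.log n :=
  le_mul_of_one_le_left (Real.log_natCast_nonneg n) (by exact_mod_cast hd)

theorem lt_log_natCast (hn : 2 ≤ n) : 0.69 < Real.log n := by
  have h2 : Real.log 2 ≤ Real.log n := Real.log_le_log two_pos (by exact_mod_cast hn)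
  linarith [Real.log_two_gt_d9]

theorem exp_neg_two_mul_log_le (hδ : 0 < δ) (hδ1 : δ < 1) :
    Real.exp (-(2 * Real.log (2 / δ))) ≤ δ / 4 := by
  calc Real.exp (-(2 * Real.log (2 / δ))) = (δ / 2) ^ 2 := by
        rw [← Real.exp_log (by positivity : 0 < δ / 2), ← Real.exp_nat_mul, ← inv_div δ,
          Real.log_inv]
        congr 1
        push_cast
        ring
    _ ≤ δ / 4 := by nlinarith

theorem le_sq_mul_of_sampleSize (hε : 0 < ε)
    (hk : 10000 * (d * Real.log n / ε ^ 2) * Real.log (2 / δ) ^ 2 ≤ (k : ℝ)) :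
    10000 * (d * Real.log n) * Real.log (2 / δ) ^ 2 ≤ ε ^ 2 * k := by
  rw [mul_comm (ε ^ 2), ← div_le_iff₀ (by positivity)]
  exact le_of_eq_of_le (by ring) hk

theorem deviation_eq_div (Cδ : ℝ) (d n k : ℕ) :
    deviation Cδ d n k = Cδ * √(k * d * Real.log n) / n :=
  div_mul_eq_mul_div _ _ _

theorem confidenceConst_mul_sqrt_sq (δ : ℝ) (d n k : ℕ) :
    (confidenceConst 10 δ * √(k * d * Real.log n)) ^ 2 =
      400 * (d * Real.log n) * Real.log (2 / δ) ^ 2 * k := by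
  have := Real.log_natCast_nonneg n
  rw [mul_pow, Real.sq_sqrt (by positivity), confidenceConst]
  ring

theorem confidenceConst_nonneg (hδ : 0 < δ) (hδ1 : δ < 1) : 0 ≤ confidenceConst 10 δ := by
  have := lt_log_two_div hδ hδ1
  rw [confidenceConst]
  linarith

theorem deviation_nonneg (hδ : 0 < δ) (hδ1 : δ < 1) :
    0 ≤ deviation (confidenceConst 10 δ) d n k := by
  have := confidenceConst_nonneg hδ hδ1
  rw [deviation]
  positivity

theorem two_le_confidenceConst_mul_sqrt (hd : 1 ≤ d) (hn : 2 ≤ n) (hk : 1 ≤ k) (hδ : 0 < δ)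
    (hδ1 : δ < 1) : 2 ≤ confidenceConst 10 δ * √(k * d * Real.log n) := by
  have := confidenceConst_nonneg hδ hδ1
  refine le_of_sq_le_sq ?_ (by positivity)
  have hD : 0.69 ≤ d * Real.log n := (lt_log_natCast hn).le.trans (log_le_natCast_mul_log hd)
  have hL := lt_log_two_div hδ hδ1
  have hk1 : (1 : ℝ) ≤ k := by exact_mod_cast hk
  calc (2 : ℝ) ^ 2 ≤ 400 * 0.69 * 0.69 ^ 2 * 1 := by norm_num
    _ ≤ 400 * (d * Real.log n) * Real.log (2 / δ) ^ 2 * k := by gcongr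
    _ = _ := (confidenceConst_mul_sqrt_sq δ d n k).symm

theorem confidenceConst_mul_sqrt_le (hε : 0 < ε)
    (hk : 10000 * (d * Real.log n / ε ^ 2) * Real.log (2 / δ) ^ 2 ≤ (k : ℝ)) :
    confidenceConst 10 δ * √(k * d * Real.log n) ≤ ε / 5 * k := by
  refine le_of_sq_le_sq ?_ (by positivity)
  calc (confidenceConst 10 δ * √(k * d * Real.log n)) ^ 2
      = 10000 * (d * Real.log n) * Real.log (2 / δ) ^ 2 * (k / 25) := by
        rw [confidenceConst_mul_sqrt_sq]; ring
    _ ≤ ε ^ 2 * k * (k / 25) :=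
        mul_le_mul_of_nonneg_right (le_sq_mul_of_sampleSize hε hk) (by positivity)
    _ = (ε / 5 * k) ^ 2 := by ring

theorem deviation_le (hε : 0 < ε)
    (hk : 10000 * (d * Real.log n / ε ^ 2) * Real.log (2 / δ) ^ 2 ≤ (k : ℝ)) :
    deviation (confidenceConst 10 δ) d n k ≤ ε / 5 * (k / n) := by
  rw [deviation_eq_div, ← mul_div_assoc]
  exact div_le_div_of_nonneg_right (confidenceConst_mul_sqrt_le hε hk) (Nat.cast_nonneg n)

theorem natCast_mul_exp_le (hd : 1 ≤ d) (hn : 2 ≤ n) (hδ : 0 < δ) (hδ1 : δ < 1) :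
    n * Real.exp (-(25 * (d * Real.log n) * Real.log (2 / δ) ^ 2)) ≤ δ / 4 := by
  refine le_trans ?_ (exp_neg_two_mul_log_le hδ hδ1)
  have hn0 : (0 : ℝ) < n := by positivity
  have hlog := lt_log_natCast hn
  have hD := log_le_natCast_mul_log (n := n) hd
  have hL := lt_log_two_div hδ hδ1
  nth_rewrite 1 [← Real.exp_log hn0]
  rw [← Real.exp_add, Real.exp_le_exp]
  set D := d * Real.log n
  set L := Real.log (2 / δ)
  have hD0 : 0.69 ≤ D := hlog.le.trans hD
  have hDL : D * 0.69 ^ 2 ≤ D * L ^ 2 := by gcongr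
  have hLD : 0.69 * 0.69 * L ≤ D * L * L := by gcongr
  linarith [show D * L * L = D * L ^ 2 by ring]

theorem hitMass_pos (hd : 1 ≤ d) (hn : 2 ≤ n) (hδ : 0 < δ) (hδ1 : δ < 1) :
    0 < hitMass d n δ := by
  have hL := lt_log_two_div hδ hδ1
  have hlog := lt_log_natCast hn
  rw [hitMass]
  positivity

theorem net_card_bound_le (hd : 1 ≤ d) (hn : 2 ≤ n) (hdn : d ≤ n) (hδ : 0 < δ) (hδ1 : δ < 1) :
    17 * (200 * d) ^ d / hitMass d n δ ≤ Real.exp (10 * (d * Real.log n)) := by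
  have hn0 : (0 : ℝ) < n := by positivity
  have hn2 : (2 : ℝ) ≤ n := by exact_mod_cast hn
  have hD : 0.69 ≤ d * Real.log n := (lt_log_natCast hn).le.trans (log_le_natCast_mul_log hd)
  have hDL : 0.4 ≤ d * Real.log n * Real.log (2 / δ) := by
    nlinarith [lt_log_two_div hδ hδ1]
  have h200 : (200 : ℝ) ≤ n ^ 8 :=
    calc (200 : ℝ) ≤ 2 ^ 8 := by norm_num
      _ ≤ n ^ 8 := by gcongr
  have hexp : ((n : ℝ) ^ 10) ^ d = Real.exp (10 * (d * Real.log n)) := by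
    rw [← pow_mul, mul_left_comm, ← Real.exp_log (pow_pos hn0 _), Real.log_pow]
    push_cast
    ring_nf
  calc 17 * (200 * d) ^ d / hitMass d n δ
      ≤ 17 * (n ^ 8 * n) ^ d / (400 * 0.4 / n) := by rw [hitMass]; gcongr
    _ = 17 / 160 * (n * (n ^ 9) ^ d) := by field_simp; ring
    _ ≤ 1 * (n ^ d * (n ^ 9) ^ d) := by
        gcongr
        · norm_num
        · exact le_self_pow₀ (by linarith) (by omega)
    _ = ((n : ℝ) ^ 10) ^ d := by rw [one_mul, ← mul_pow, ← pow_succ']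
    _ = _ := hexp

theorem net_mul_exp_le (hd : 1 ≤ d) (hn : 2 ≤ n) (hdn : d ≤ n) (hδ : 0 < δ) (hδ1 : δ < 1) :
    (17 * (200 * d) ^ d / hitMass d n δ) ^ 2 * Real.exp (-(n * (hitMass d n δ / 4))) ≤
      δ / 4 := by
  have : (0 : ℝ) < n := by positivity
  have hD : 0.69 ≤ d * Real.log n := (lt_log_natCast hn).le.trans (log_le_natCast_mul_log hd)
  have hL := lt_log_two_div hδ hδ1
  have hq := hitMass_pos hd hn hδ hδ1
  calc (17 * (200 * d) ^ d / hitMass d n δ) ^ 2 * Real.exp (-(n * (hitMass d n δ / 4)))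
      ≤ Real.exp (10 * (d * Real.log n)) ^ 2 * Real.exp (-(n * (hitMass d n δ / 4))) := by
        gcongr
        exact net_card_bound_le hd hn hdn hδ hδ1
    _ = Real.exp (20 * (d * Real.log n) - 100 * (d * Real.log n * Real.log (2 / δ))) := by
        rw [← Real.exp_nat_mul, ← Real.exp_add, hitMass]
        congr 1
        field_simp
        push_cast
        ring
    _ ≤ Real.exp (-(2 * Real.log (2 / δ))) := by
        rw [Real.exp_le_exp]
        nlinarith
    _ ≤ δ / 4 := exp_neg_two_mul_log_le hδ hδ1

theorem dimension_le_of_sampleSize (hn : 2 ≤ n) (hkn : k ≤ n) (hδ : 0 < δ) (hδ1 : δ < 1)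
    (hε : 0 < ε) (hε1 : ε < 1)
    (hk : 10000 * (d * Real.log n / ε ^ 2) * Real.log (2 / δ) ^ 2 ≤ (k : ℝ)) : d ≤ n := by
  have hL := lt_log_two_div hδ hδ1
  have hlog := lt_log_natCast hn
  have hdk : (d : ℝ) ≤ k :=
    calc (d : ℝ) ≤ 10000 * (d * 0.69) * 0.69 ^ 2 := by
          linarith [Nat.cast_nonneg (α := ℝ) d]
      _ ≤ 10000 * (d * Real.log n) * Real.log (2 / δ) ^ 2 := by gcongr
      _ ≤ ε ^ 2 * k := le_sq_mul_of_sampleSize hε hk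
      _ ≤ k := mul_le_of_le_one_left (Nat.cast_nonneg _) (pow_le_one₀ hε.le hε1.le)
  exact (Nat.cast_le.1 hdk).trans hkn

theorem IsDensityOn.measureReal_not_isTypicalSample_le_of_sampleSize {X : Set (Space d)}
    {f : Space d → ℝ} (hd : 1 ≤ d) (hn : 2 ≤ n) (hk1 : 1 ≤ k) (hkn : k ≤ n)
    (hf : IsDensityOn X f) (hδ : 0 < δ) (hδ1 : δ < 1) (hε : 0 < ε) (hε1 : ε < 1)
    (hk : 10000 * (d * Real.log n / ε ^ 2) * Real.log (2 / δ) ^ 2 ≤ (k : ℝ)) :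
    (sampleMeasure f n).real {x | ¬ IsTypicalSample X f k
      (deviation (confidenceConst 10 δ) d n k) (hitMass d n δ) x} ≤ δ := by
  rw [deviation_eq_div]
  have hk0 : (0 : ℝ) < k := by exact_mod_cast hk1
  set Δ := confidenceConst 10 δ * √(k * d * Real.log n)
  have hΔk : Δ ≤ k :=
    (confidenceConst_mul_sqrt_le hε hk).trans (mul_le_of_le_one_left hk0.le (by linarith))
  have hΔsq : 25 * (d * Real.log n) * Real.log (2 / δ) ^ 2 = Δ ^ 2 / (16 * k) := by
    rw [confidenceConst_mul_sqrt_sq]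
    field_simp
    ring
  have hmany := natCast_mul_exp_le hd hn hδ hδ1
  rw [hΔsq] at hmany
  have hfew : n * Real.exp (-(Δ ^ 2 / (8 * k))) ≤ n * Real.exp (-(Δ ^ 2 / (16 * k))) := by
    gcongr
    norm_num
  linarith [hf.measureReal_not_isTypicalSample_le (n := n) hd hk1
      (two_le_confidenceConst_mul_sqrt hd hn hk1 hδ hδ1) hΔk (hitMass_pos hd hn hδ hδ1),
    net_mul_exp_le hd hn (dimension_le_of_sampleSize hn hkn hδ hδ1 hε hε1 hk) hδ hδ1]

end Numerics

/-! ### Chains of data points -/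

theorem eventually_forall_le_imp_le {ι β γ : Type*} [Finite ι] [TopologicalSpace β]
    [TopologicalSpace γ] [LinearOrder γ] [OrderClosedTopology γ] (u : ι → γ) {g : β → γ} {b : β}
    (hg : ContinuousAt g b) : ∀ᶠ t in 𝓝 b, ∀ i, u i ≤ g t → u i ≤ g b := by
  refine eventually_all.2 fun i => ?_
  rcases le_or_gt (u i) (g b) with hi | hi
  · exact .of_forall fun _ _ => hi
  · filter_upwards [hg.eventually_lt_const hi] with t ht hle
    exact absurd hle ht.not_ge

section Chains

variable {ι E : Type*} [SeminormedAddCommGroup E] {x : ι → E} {A : Set E} {s t : ℝ}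

theorem eventually_exists_dist_le [Finite ι]
    (hit : ∀ y ∈ A, ∀ b, dist b y ≤ s → ∃ l, dist (x l) y ≤ s ∧ dist (x l) b ≤ t)
    {y c : E} (hc : dist c y ≤ s) :
    ∀ᶠ y' in 𝓝[A] y, ∃ l, dist (x l) y' ≤ s ∧ dist (x l) c ≤ t := by
  have hev : ∀ᶠ y' in 𝓝 y, ∀ l, dist (x l) c ≤ t + dist y' y → dist (x l) c ≤ t := by
    simpa using eventually_forall_le_imp_le (fun l => dist (x l) c)
      (g := fun y' => t + dist y' y) (b := y) (by fun_prop)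
  filter_upwards [hev.filter_mono nhdsWithin_le_nhds, self_mem_nhdsWithin] with y' hy' hyA
  -- the centre `c` is translated along with `y`, so that it stays within `s` of the moved point
  obtain ⟨l, hly, hlc⟩ := hit y' hyA (c + (y' - y))
    (by rwa [dist_eq_norm, show c + (y' - y) - y' = c - y by abel, ← dist_eq_norm])
  refine ⟨l, hly, hy' l ?_⟩
  calc dist (x l) c ≤ dist (x l) (c + (y' - y)) + dist (c + (y' - y)) c := dist_triangle _ _ _
    _ = dist (x l) (c + (y' - y)) + dist y' y := by rw [dist_self_add_left, dist_eq_norm y' y]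
    _ ≤ t + dist y' y := by gcongr

theorem reachable_of_isPreconnected [Finite ι] (G : SimpleGraph ι) (hA : IsPreconnected A)
    (hs : 0 ≤ s) (hst : s ≤ t)
    (hit : ∀ y ∈ A, ∀ b, dist b y ≤ s → ∃ l, dist (x l) y ≤ s ∧ dist (x l) b ≤ t)
    (hG : ∀ l m, l ≠ m → (∃ y ∈ A, dist (x l) y ≤ s) → (∃ y ∈ A, dist (x m) y ≤ s) →
      dist (x l) (x m) ≤ t → G.Adj l m)
    {i j : ι} (hi : x i ∈ A) (hj : x j ∈ A) : G.Reachable i j := by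
  have := isPreconnected_iff_preconnectedSpace.1 hA
  have extend {l m : ι} {y y' : A} (hil : G.Reachable i l) (hl : dist (x l) y ≤ s)
      (hm : dist (x m) y' ≤ s) (hml : dist (x m) (x l) ≤ t) : G.Reachable i m := by
    rcases eq_or_ne m l with rfl | hne
    · exact hil
    · exact hil.trans (hG m l hne ⟨y', y'.2, hm⟩ ⟨y, y.2, hl⟩ hml).symm.reachable
  let S : Set A := {y | ∃ l, G.Reachable i l ∧ dist (x l) y ≤ s}
  have isOpen_S : IsOpen S := by
    refine isOpen_iff_eventually.2 ?_
    rintro y ⟨l, hil, hl⟩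
    refine eventually_nhds_subtype_iff A y
      (fun y' => ∃ m, G.Reachable i m ∧ dist (x m) y' ≤ s) |>.2 ?_
    filter_upwards [eventually_exists_dist_le hit hl, self_mem_nhdsWithin] with y' hm hy'
    obtain ⟨m, hm, hml⟩ := hm
    exact ⟨m, extend (y' := ⟨y', hy'⟩) hil hl hm hml, hm⟩
  have isClosed_S : IsClosed S := by
    have hS : S = ⋃ l ∈ {l | G.Reachable i l}, {y : A | dist (x l) y ≤ s} := by
      ext y
      simp [S]
    rw [hS]
    exact (Set.toFinite _).isClosed_biUnion fun l _ => isClosed_le (by fun_prop) (by fun_prop)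
  have eq_univ_S : S = Set.univ := IsClopen.eq_univ ⟨isClosed_S, isOpen_S⟩
    ⟨⟨x i, hi⟩, i, .refl i, by simpa using hs⟩
  obtain ⟨l, hil, hl⟩ : (⟨x j, hj⟩ : A) ∈ S := eq_univ_S ▸ Set.mem_univ _
  exact extend (y := ⟨x j, hj⟩) (y' := ⟨x j, hj⟩) hil hl (by simpa using hs)
    (by simpa only [dist_comm] using hl.trans hst)

theorem joinedIn_of_reachable [NormedSpace ℝ E] {G : SimpleGraph ι} {R : ℝ} (hR : 0 ≤ R)
    (hG : ∀ l m, G.Adj l m → dist (x l) (x m) ≤ 2 * R) {i j : ι} (h : G.Reachable i j) :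
    JoinedIn {z | z ∈ convexHull ℝ (Set.range x) ∧ ∃ m, G.Reachable i m ∧ dist z (x m) ≤ R}
      (x i) (x j) := by
  have mem_hull (l : ι) : x l ∈ convexHull ℝ (Set.range x) :=
    subset_convexHull ℝ _ (Set.mem_range_self l)
  rw [SimpleGraph.reachable_iff_reflTransGen] at h
  induction h with
  | refl => exact JoinedIn.refl ⟨mem_hull i, i, .refl i, by simpa using hR⟩
  | @tail l m hil hlm ih =>
    rw [← SimpleGraph.reachable_iff_reflTransGen] at hil
    refine ih.trans (JoinedIn.of_segment_subset fun z hz =>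
      ⟨(convex_convexHull ℝ _).segment_subset (mem_hull l) (mem_hull m) hz, ?_⟩)
    rcases le_total (dist z (x l)) R with hzl | hzl
    · exact ⟨l, hil, hzl⟩
    · refine ⟨m, hil.trans hlm.reachable, ?_⟩
      linarith [dist_add_dist_of_mem_segment hz, hG l m hlm, dist_comm (x l) z]

end Chains

/-! ### Nodes, edges and levels -/

section Graph

variable {d n : ℕ}

theorem mem_buffer_iff {Z : Set (Space d)} {σ : ℝ} {z : Space d} :
    z ∈ buffer Z σ ↔ ∃ a ∈ Z, dist z a ≤ σ := by
  rw [buffer, Set.mem_add]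
  constructor
  · rintro ⟨a, ha, b, hb, rfl⟩
    exact ⟨a, ha, by simpa [dist_eq_norm] using hb⟩
  · rintro ⟨a, ha, hz⟩
    exact ⟨a, ha, z - a, by simpa [dist_eq_norm] using hz, by simp⟩

variable {k : ℕ} {x : Fin n → Space d}

theorem knnRadius_le_iff {i : Fin n} {ρ : ℝ≥0∞} (hρ : ρ ≠ ⊤) :
    knnRadius k x i ≤ ρ ↔ k ≤ {j | edist (x j) (x i) ≤ ρ}.ncard := by
  refine ⟨fun h => ?_, fun h => sInf_le h⟩
  have hev : ∀ᶠ r in 𝓝[>] ρ, ∀ j, edist (x j) (x i) ≤ r → edist (x j) (x i) ≤ ρ :=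
    (eventually_forall_le_imp_le _ continuousAt_id).filter_mono nhdsWithin_le_nhds
  have := nhdsGT_neBot_of_exists_gt ⟨⊤, hρ.lt_top⟩
  obtain ⟨r, hr, hρr⟩ := (hev.and self_mem_nhdsWithin).exists
  obtain ⟨r', hr', hlt⟩ := sInf_lt_iff.1 (h.trans_lt hρr)
  exact hr'.trans (Set.ncard_le_ncard fun j hj => hr j (hj.trans hlt.le))

theorem mem_nodes_ofReal_iff {i : Fin n} {R : ℝ} (hR : 0 ≤ R) :
    i ∈ nodes k x (ENNReal.ofReal R) ↔ k ≤ {j | dist (x j) (x i) ≤ R}.ncard := by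
  simp_rw [nodes, Set.mem_ofPred_eq, knnRadius_le_iff ENNReal.ofReal_ne_top, edist_le_ofReal hR]

theorem edgeScale_mono (alg : Algorithm) {r r' : ℝ≥0∞} (h : r ≤ r') (i j : Fin n) :
    edgeScale alg k x r i j ≤ edgeScale alg k x r' i j := by
  cases alg
  · exact h
  · exact le_rfl
  · exact le_rfl

theorem edgeScale_le (alg : Algorithm) {r : ℝ≥0∞} {i j : Fin n} (hi : i ∈ nodes k x r)
    (hj : j ∈ nodes k x r) : edgeScale alg k x r i j ≤ r := by
  cases alg
  · exact le_rfl
  · exact min_le_of_left_le hi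
  · exact max_le hi hj

variable {alg : Algorithm} {α Cδ ε' : ℝ} {r : ℝ≥0∞}

theorem levelGraph_mono {r' : ℝ≥0∞} (h : r ≤ r') :
    levelGraph alg α k x r ≤ levelGraph alg α k x r' := by
  rintro i j ⟨hne, hi, hj, hdist⟩
  refine ⟨hne, le_trans hi h, le_trans hj h, hdist.trans ?_⟩
  gcongr
  exact edgeScale_mono alg h i j

theorem levelGraph_le_prunedGraph : levelGraph alg α k x r ≤ prunedGraph alg α k Cδ ε' x r :=
  fun _ _ h => ⟨h.1, h.2.1, h.2.2.1, Or.inl h⟩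

theorem reachable_lookupRadius_of_reachable_prunedGraph (h : r ≤ lookupRadius Cδ ε' d n k r)
    {i j : Fin n} (hij : (prunedGraph alg α k Cδ ε' x r).Reachable i j) :
    (levelGraph alg α k x (lookupRadius Cδ ε' d n k r)).Reachable i j := by
  rw [SimpleGraph.reachable_iff_reflTransGen] at hij ⊢
  refine Relation.reflTransGen_closed (fun l m hlm => ?_) _ _ hij
  rw [← SimpleGraph.reachable_iff_reflTransGen]
  exact hlm.2.2.2.elim (fun hadj => (levelGraph_mono h hadj).reachable) id

theorem mem_nodes_of_reachable_levelGraph {i j : Fin n} (hi : i ∈ nodes k x r)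
    (hij : (levelGraph alg α k x r).Reachable i j) : j ∈ nodes k x r := by
  rw [SimpleGraph.reachable_iff_reflTransGen] at hij
  cases hij with
  | refl => exact hi
  | tail _ hadj => exact hadj.2.2.1

theorem dist_le_of_levelGraph_adj (hα : α ≤ 2) {R : ℝ} (hR : 0 ≤ R) {i j : Fin n}
    (h : (levelGraph alg α k x (ENNReal.ofReal R)).Adj i j) : dist (x i) (x j) ≤ 2 * R := by
  obtain ⟨-, hi, hj, hdist⟩ := h
  rw [← edist_le_ofReal (by positivity), ENNReal.ofReal_mul zero_le_two]
  refine hdist.trans ?_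
  gcongr
  exact edgeScale_le alg hi hj

theorem levelRadius_antitone (Cδ : ℝ) (d n k : ℕ) : Antitone (levelRadius Cδ d n k) := by
  intro a b hab
  unfold levelRadius
  have := unitBallVolume_pos d
  gcongr

theorem exists_mul_pow_mul_eq (hd : d ≠ 0) {a b : ℝ} (ha : 0 < a) (hb : 0 < b) :
    0 < (a / (unitBallVolume d * b)) ^ (1 / d : ℝ) ∧
      unitBallVolume d * ((a / (unitBallVolume d * b)) ^ (1 / d : ℝ)) ^ d * b = a := by
  have hv := unitBallVolume_pos d
  refine ⟨by positivity, ?_⟩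
  rw [one_div, Real.rpow_inv_natCast_pow (by positivity) hd]
  field_simp

theorem exists_levelRadius_eq (hd : d ≠ 0) {lam : ℝ} (hlam : 0 < lam)
    (hpos : 0 < (k : ℝ) / n + deviation Cδ d n k) :
    ∃ R : ℝ, 0 < R ∧ levelRadius Cδ d n k lam = ENNReal.ofReal R ∧
      unitBallVolume d * R ^ d * lam = k / n + deviation Cδ d n k := by
  have hv := unitBallVolume_pos d
  obtain ⟨hR, hR_eq⟩ := exists_mul_pow_mul_eq hd hpos hlam
  refine ⟨_, hR, ?_, hR_eq⟩
  rw [levelRadius, ← ENNReal.ofReal_div_of_pos (by positivity),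
    ENNReal.ofReal_rpow_of_pos (by positivity)]

end Graph

/-! ### Connectedness of the data points of a high-density set -/

section HighDensity

variable {d n k : ℕ} {X A : Set (Space d)} {f : Space d → ℝ} {e q σ lam R : ℝ}
  {x : Fin n → Space d}

theorem IsDensityOn.mem_nodes_ofReal (hf : IsDensityOn X f)
    (hcount : ∀ i r, k / n + e ≤ (densityMeasure f).real (Metric.closedBall (x i) r) →
      k ≤ {j | dist (x j) (x i) ≤ r}.ncard)
    (hlam : 0 ≤ lam) (hA : ∀ z ∈ buffer A σ, lam ≤ f z) (hR : 0 ≤ R) (hRσ : 2 * R ≤ σ)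
    (hRlam : unitBallVolume d * R ^ d * lam = k / n + e) {i : Fin n} {y : Space d} (hy : y ∈ A)
    (hi : dist (x i) y ≤ R) : i ∈ nodes k x (ENNReal.ofReal R) := by
  rw [mem_nodes_ofReal_iff hR]
  refine hcount i R ?_
  rw [← hRlam, ← volumeReal_closedBall (x i) hR, mul_comm]
  refine hf.mul_volumeReal_le Metric.isClosed_closedBall.measurableSet (fun z hz => ?_) hlam
  refine hA z (mem_buffer_iff.2 ⟨y, hy, ?_⟩)
  linarith [dist_triangle z (x i) y, Metric.mem_closedBall.1 hz]

theorem IsTypicalSample.ofReal_le_knnRadius (hx : IsTypicalSample X f k e q x) {M s : ℝ}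
    (hM0 : 0 ≤ M) (hM : ∀ z, f z ≤ M) (hs : 0 ≤ s)
    (hsM : unitBallVolume d * s ^ d * M = k / n - e) (i : Fin n) :
    ENNReal.ofReal s ≤ knnRadius k x i := by
  by_contra! hlt
  set ρ := (knnRadius k x i).toReal
  have hρ : 0 ≤ ρ := ENNReal.toReal_nonneg
  have hρs : ρ ≤ s := ENNReal.toReal_le_of_le_ofReal hs hlt.le
  have hmem : i ∈ nodes k x (ENNReal.ofReal ρ) :=
    (ENNReal.ofReal_toReal hlt.ne_top).ge
  rw [mem_nodes_ofReal_iff hρ] at hmem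
  refine hmem.not_gt (hx.ncard_lt i ρ ?_)
  have hv := unitBallVolume_pos d
  calc (densityMeasure f).real (Metric.closedBall (x i) ρ)
      ≤ M * (unitBallVolume d * ρ ^ d) := densityMeasure_real_closedBall_le hρ (fun z _ => hM z) hM0
    _ ≤ M * (unitBallVolume d * s ^ d) := by gcongr
    _ = k / n - e := by rw [← hsM]; ring

theorem IsTypicalSample.exists_connectionScale (hd : d ≠ 0) (hx : IsTypicalSample X f k e q x)
    (he0 : 0 ≤ e) (he : e < k / n) (hq : q ≤ k / n) (alg : Algorithm) (hlam : 0 < lam)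
    (hR : 0 < R) (hRlam : unitBallVolume d * R ^ d * lam = k / n + e) {z : Space d}
    (hz : lam ≤ f z)
    (hM : alg ≠ .linkage → ∃ M, (∀ z, f z ≤ M) ∧ M * q ≤ lam * (k / n - e)) :
    ∃ s : ℝ, 0 < s ∧ s ≤ R ∧ q ≤ unitBallVolume d * s ^ d * lam ∧
      ∀ l m, ENNReal.ofReal s ≤ edgeScale alg k x (ENNReal.ofReal R) l m := by
  by_cases halg : alg = .linkage
  · subst halg
    exact ⟨R, hR, le_rfl, by linarith, fun _ _ => le_rfl⟩
  obtain ⟨M, hfM, hMq⟩ := hM halg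
  have hlamM : lam ≤ M := hz.trans (hfM z)
  have hM0 : 0 < M := hlam.trans_le hlamM
  have hv := unitBallVolume_pos d
  -- `s` is the scale below which no ball is heavy enough to hold `k` data points
  obtain ⟨hs, hsM⟩ := exists_mul_pow_mul_eq hd (sub_pos.2 he) hM0
  set s := (((k : ℝ) / n - e) / (unitBallVolume d * M)) ^ (1 / d : ℝ)
  have hknn := hx.ofReal_le_knnRadius hM0.le hfM hs.le hsM
  refine ⟨s, hs, ?_, ?_, fun l m => ?_⟩
  · refine le_of_pow_le_pow_left₀ hd hR.le ?_
    refine le_of_mul_le_mul_left (a := unitBallVolume d * lam) ?_ (by positivity)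
    calc unitBallVolume d * lam * s ^ d = unitBallVolume d * s ^ d * lam := by ring
      _ ≤ unitBallVolume d * s ^ d * M := by gcongr
      _ ≤ unitBallVolume d * R ^ d * lam := by rw [hsM, hRlam]; linarith
      _ = unitBallVolume d * lam * R ^ d := by ring
  · refine le_of_mul_le_mul_left ?_ hM0
    calc M * q ≤ lam * (k / n - e) := hMq
      _ = M * (unitBallVolume d * s ^ d * lam) := by rw [← hsM]; ring
  · cases alg
    · exact absurd rfl halg
    · exact le_min (hknn l) (hknn m)
    · exact (hknn l).trans (le_max_left _ _)

theorem IsTypicalSample.reachable_levelGraph (hd : d ≠ 0) (hf : IsDensityOn X f)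
    (hx : IsTypicalSample X f k e q x) (he0 : 0 ≤ e) (he : e < k / n) (hq : q ≤ k / n)
    {alg : Algorithm} {α : ℝ} (hα : √2 ≤ α) (hlam : 0 < lam)
    (hA : ∀ z ∈ buffer A σ, lam ≤ f z) (hR : 0 < R) (hRσ : 2 * R ≤ σ)
    (hRlam : unitBallVolume d * R ^ d * lam = k / n + e)
    (hM : alg ≠ .linkage → ∃ M, (∀ z, f z ≤ M) ∧ M * q ≤ lam * (k / n - e))
    (hconn : IsPreconnected A) {i j : Fin n} (hi : x i ∈ A) (hj : x j ∈ A) :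
    (levelGraph alg α k x (ENNReal.ofReal R)).Reachable i j := by
  have hv := unitBallVolume_pos d
  have le_near {y z : Space d} (hy : y ∈ A) (hzy : dist z y ≤ 2 * R) : lam ≤ f z :=
    hA z (mem_buffer_iff.2 ⟨y, hy, hzy.trans hRσ⟩)
  obtain ⟨s, hs, hsR, hqs, hedge⟩ := hx.exists_connectionScale hd he0 he hq alg hlam hR hRlam
    (le_near hi (z := x i) (by simpa using hR.le)) hM
  refine reachable_of_isPreconnected (t := √2 * s) _ hconn hs.le
    (le_mul_of_one_le_left hs.le (Real.one_le_sqrt.2 one_le_two)) (fun y hy b hb => ?_) ?_ hi hj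
  · refine hx.hitsHalfBalls s hs y b hb fun z hz => ?_
    rw [div_le_iff₀' (by positivity)]
    refine hqs.trans (mul_le_mul_of_nonneg_left (le_near hy ?_) (by positivity))
    exact (Metric.mem_closedBall.1 hz).trans (by gcongr)
  · have mem_nodes {l : Fin n} (hl : ∃ y ∈ A, dist (x l) y ≤ s) :
        l ∈ nodes k x (ENNReal.ofReal R) := by
      obtain ⟨y, hy, hly⟩ := hl
      exact hf.mem_nodes_ofReal hx.le_ncard hlam.le hA hR.le hRσ hRlam hy (hly.trans hsR)
    intro l m hne hl hm hdist
    refine ⟨hne, mem_nodes hl, mem_nodes hm, ?_⟩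
    have hα0 : 0 ≤ α := (Real.sqrt_nonneg _).trans hα
    calc edist (x l) (x m) ≤ ENNReal.ofReal (α * s) := by
          rw [edist_le_ofReal (by positivity)]
          exact hdist.trans (by gcongr)
      _ = ENNReal.ofReal α * ENNReal.ofReal s := ENNReal.ofReal_mul hα0
      _ ≤ ENNReal.ofReal α * edgeScale alg k x (ENNReal.ofReal R) l m := by gcongr; exact hedge l m

end HighDensity

/-! ### Density thresholds and level radii -/

/-- The density `k / (n v_d (σ / 2) ^ d)` at which a ball of radius `σ / 2` has mass `k / n`. It
is the main term of the threshold `λ_o`. -/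
def bufferDensity (d n k : ℕ) (σ : ℝ) : ℝ := k / (n * unitBallVolume d * (σ / 2) ^ d)

section Threshold

variable {d n k : ℕ} {X : Set (Space d)} {f : Space d → ℝ} {alg : Algorithm}
  {C Cδ δ ε ε' σ lam : ℝ}

theorem bufferDensity_pos (hn : 1 ≤ n) (hk1 : 1 ≤ k) (hσ : 0 < σ) : 0 < bufferDensity d n k σ := by
  have hv := unitBallVolume_pos d
  have : (0 : ℝ) < n := by exact_mod_cast hn
  have : (0 : ℝ) < k := by exact_mod_cast hk1
  rw [bufferDensity]
  positivity

theorem bufferDensity_mul (hn : 1 ≤ n) (hσ : 0 < σ) :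
    bufferDensity d n k σ * (unitBallVolume d * (σ / 2) ^ d) = k / n := by
  have hv := unitBallVolume_pos d
  have : (0 : ℝ) < n := by exact_mod_cast hn
  rw [bufferDensity]
  field_simp

theorem bufferDensity_mul_add_le (hε1 : ε < 1)
    (h : densityThreshold alg X f C δ ε ε' σ n k ≤ (lam : EReal)) :
    bufferDensity d n k σ * (1 + ε) + ε' ≤ (1 - ε) * lam := by
  have hbase : bufferDensity d n k σ * ((1 + ε) / (1 - ε)) + ε' / (1 - ε) ≤ lam := by
    rw [← EReal.coe_le_coe_iff]
    cases alg
    · exact h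
    · exact (le_max_left _ _).trans h
    · exact (le_max_left _ _).trans h
  have hε : 0 < 1 - ε := by linarith
  calc bufferDensity d n k σ * (1 + ε) + ε'
      = (1 - ε) * (bufferDensity d n k σ * ((1 + ε) / (1 - ε)) + ε' / (1 - ε)) := by field_simp
    _ ≤ (1 - ε) * lam := by gcongr

theorem pos_of_densityThreshold_le (hn : 1 ≤ n) (hk1 : 1 ≤ k) (hε : 0 < ε) (hε1 : ε < 1)
    (hε' : 0 < ε') (hσ : 0 < σ)
    (h : densityThreshold alg X f C δ ε ε' σ n k ≤ (lam : EReal)) : 0 < lam := by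
  have hpos := mul_pos (bufferDensity_pos (d := d) hn hk1 hσ) (by linarith : 0 < 1 + ε)
  exact pos_of_mul_pos_right (by linarith [bufferDensity_mul_add_le hε1 h])
    (by linarith : 0 ≤ 1 - ε)

theorem le_supOn {Z : Set (Space d)} {z : Space d} (hz : z ∈ Z) : (f z : EReal) ≤ supOn f Z :=
  le_iSup₂ (f := fun z (_ : z ∈ Z) => (f z : EReal)) z hz

theorem IsDensityOn.exists_bound_of_supOn_mul_le (hf : IsDensityOn X f) {z₀ : Space d}
    (hz₀ : 0 < f z₀) {c : ℝ} (hc : 0 < c) (h : supOn f X * (c : EReal) ≤ (lam : EReal)) :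
    ∃ M, (∀ z, f z ≤ M) ∧ M * c ≤ lam := by
  have hz₀X : z₀ ∈ X := by
    by_contra hz
    exact hz₀.ne' (hf.eq_zero_of_notMem z₀ hz)
  have ne_top : supOn f X ≠ ⊤ := by
    intro htop
    rw [htop, EReal.top_mul_coe_of_pos hc] at h
    exact EReal.coe_ne_top _ (top_le_iff.1 h)
  have ne_bot : supOn f X ≠ ⊥ := ne_bot_of_le_ne_bot (EReal.coe_ne_bot _) (le_supOn hz₀X)
  lift supOn f X to ℝ using ⟨ne_top, ne_bot⟩ with M hM
  have le_M {z : Space d} (hz : z ∈ X) : f z ≤ M :=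
    EReal.coe_le_coe_iff.1 (hM ▸ le_supOn hz)
  refine ⟨M, fun z => ?_, by exact_mod_cast h⟩
  by_cases hz : z ∈ X
  · exact le_M hz
  · exact (hf.eq_zero_of_notMem z hz).trans_le (hz₀.le.trans (le_M hz₀X))

theorem IsDensityOn.exists_bound_of_densityThreshold_le (hd : 1 ≤ d) (hn : 2 ≤ n) (hk1 : 1 ≤ k)
    (hf : IsDensityOn X f) (hδ : 0 < δ) (hδ1 : δ < 1) (halg : alg ≠ .linkage) {e lam' : ℝ}
    (he : e ≤ 1 / 5 * (k / n)) (hlam' : 0 ≤ lam') (hlam : lam ≤ 2 * lam') {z₀ : Space d}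
    (hz₀ : 0 < f z₀) (h : densityThreshold alg X f 10000 δ ε ε' σ n k ≤ (lam : EReal)) :
    ∃ M, (∀ z, f z ≤ M) ∧ M * hitMass d n δ ≤ lam' * (k / n - e) := by
  have : (0 : ℝ) < k := by exact_mod_cast hk1
  have : (0 : ℝ) < d := by exact_mod_cast hd
  have hlog : 0 < Real.log n := by linarith [lt_log_natCast hn]
  have hL : 0 < Real.log (2 / δ) := by linarith [lt_log_two_div hδ hδ1]
  have hsup : supOn f X * ((10000 * d * Real.log n * Real.log (2 / δ) / k : ℝ) : EReal) ≤ lam := by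
    cases alg
    · exact absurd rfl halg
    · exact (le_max_right _ _).trans h
    · exact (le_max_right _ _).trans h
  obtain ⟨M, hM, hMlam⟩ := hf.exists_bound_of_supOn_mul_le hz₀ (by positivity) hsup
  refine ⟨M, hM, ?_⟩
  calc M * hitMass d n δ
      = M * (10000 * d * Real.log n * Real.log (2 / δ) / k) * (1 / 25 * (k / n)) := by
        rw [hitMass]; field_simp; ring
    _ ≤ 2 * lam' * (1 / 25 * (k / n)) :=
        mul_le_mul_of_nonneg_right (hMlam.trans hlam) (by positivity)
    _ = lam' * (2 / 25 * (k / n)) := by ring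
    _ ≤ lam' * (k / n - e) := by
        have hkn : 0 ≤ (k : ℝ) / n := by positivity
        gcongr
        linarith

theorem exists_levelRadius_le (hd : d ≠ 0) (hn : 1 ≤ n) (hk1 : 1 ≤ k) (hε : 0 ≤ ε) (hσ : 0 < σ)
    (he0 : 0 ≤ deviation Cδ d n k) (he : deviation Cδ d n k ≤ ε / 5 * (k / n))
    (h : bufferDensity d n k σ * (1 + ε) ≤ lam) :
    ∃ R : ℝ, 0 < R ∧ 2 * R ≤ σ ∧ levelRadius Cδ d n k lam = ENNReal.ofReal R ∧
      unitBallVolume d * R ^ d * lam = k / n + deviation Cδ d n k := by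
  have hv := unitBallVolume_pos d
  have hP : 0 < (k : ℝ) / n :=
    div_pos (by exact_mod_cast hk1) (by exact_mod_cast hn)
  have hlam : 0 < lam :=
    (mul_pos (bufferDensity_pos hn hk1 hσ) (by linarith : 0 < 1 + ε)).trans_le h
  obtain ⟨R, hR, hRlev, hRlam⟩ := exists_levelRadius_eq (n := n) (k := k) hd hlam
    (add_pos_of_pos_of_nonneg hP he0)
  refine ⟨R, hR, ?_, hRlev, hRlam⟩
  suffices R ≤ σ / 2 by linarith
  refine le_of_pow_le_pow_left₀ hd (by positivity) ?_
  refine le_of_mul_le_mul_left (a := unitBallVolume d * lam) ?_ (by positivity)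
  calc unitBallVolume d * lam * R ^ d = k / n + deviation Cδ d n k := by rw [← hRlam]; ring
    _ ≤ k / n * (1 + ε) := by nlinarith
    _ = unitBallVolume d * (σ / 2) ^ d * (bufferDensity d n k σ * (1 + ε)) := by
        rw [← bufferDensity_mul (d := d) hn hσ]; ring
    _ ≤ unitBallVolume d * (σ / 2) ^ d * lam := by gcongr
    _ = unitBallVolume d * lam * (σ / 2) ^ d := by ring

end Threshold

section Lookup

variable {d n k : ℕ} {Cδ ε ε' σ lam R : ℝ}

theorem lookupDensity_ofReal (hR : 0 < R) : lookupDensity Cδ ε' d n k (ENNReal.ofReal R) =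
    (k / n - deviation Cδ d n k) / (unitBallVolume d * R ^ d) - ε' := by
  rw [lookupDensity, ENNReal.toReal_ofReal hR.le, one_div_mul_eq_div]

theorem one_sub_half_le_div {P e : ℝ} (hP : 0 < P) (he0 : 0 ≤ e) (hε : 0 ≤ ε)
    (he : e ≤ ε / 5 * P) : 1 - ε / 2 ≤ (P - e) / (P + e) := by
  rw [le_div_iff₀ (by linarith)]
  nlinarith [mul_nonneg he0 hε]

theorem exists_lookupRadius_eq (hd : d ≠ 0) (hn : 1 ≤ n) (hk1 : 1 ≤ k) (hε : 0 < ε) (hε1 : ε < 1)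
    (hε' : 0 ≤ ε') (hσ : 0 < σ) (he0 : 0 ≤ deviation Cδ d n k)
    (he : deviation Cδ d n k ≤ ε / 5 * (k / n)) (hlam : 0 < lam)
    (h : bufferDensity d n k σ * (1 + ε) + ε' ≤ (1 - ε) * lam) (hR : 0 < R)
    (hRlam : unitBallVolume d * R ^ d * lam = k / n + deviation Cδ d n k) :
    ∃ R' : ℝ, 0 < R' ∧ 2 * R' ≤ σ ∧
      lookupRadius Cδ ε' d n k (ENNReal.ofReal R) = ENNReal.ofReal R' ∧
      levelRadius Cδ d n k lam ≤ ENNReal.ofReal R' ∧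
      ((1 - 2 * ε) * lam - ε') * (unitBallVolume d * R' ^ d) ≤ k / n - deviation Cδ d n k := by
  have hv := unitBallVolume_pos d
  have hP : 0 < (k : ℝ) / n := div_pos (by exact_mod_cast hk1) (by exact_mod_cast hn)
  have hρ := one_sub_half_le_div hP he0 hε.le he
  set e := deviation Cδ d n k
  set ρ := (k / n - e) / (k / n + e)
  have hρ1 : ρ ≤ 1 := div_le_one_of_le₀ (by linarith) (by linarith)
  have hlook : lookupDensity Cδ ε' d n k (ENNReal.ofReal R) = lam * ρ - ε' := by
    rw [lookupDensity_ofReal hR, sub_left_inj, ← mul_div_assoc, div_eq_div_iff (by positivity)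
      (by positivity), ← hRlam]
    ring
  have hbuffer : bufferDensity d n k σ * (1 + ε) ≤ lam * ρ - ε' := by nlinarith
  have hpos : 0 ≤ lam * ρ - ε' :=
    (mul_nonneg (bufferDensity_pos hn hk1 hσ).le (by linarith)).trans hbuffer
  obtain ⟨R', hR', hRσ', hRlev', hRlam'⟩ := exists_levelRadius_le hd hn hk1 hε.le hσ he0 he hbuffer
  refine ⟨R', hR', hRσ', ?_, ?_, ?_⟩
  · rw [lookupRadius, hlook, max_eq_left hpos, hRlev']
  · rw [← hRlev']
    exact levelRadius_antitone _ _ _ _ (by nlinarith)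
  have hdensity : (1 - 2 * ε) * lam - ε' ≤ (lam * ρ - ε') * ρ := by
    have hρsq : 1 - 2 * ε ≤ ρ ^ 2 := by nlinarith
    nlinarith [mul_le_mul_of_nonneg_right hρsq hlam.le]
  calc ((1 - 2 * ε) * lam - ε') * (unitBallVolume d * R' ^ d)
      ≤ (lam * ρ - ε') * ρ * (unitBallVolume d * R' ^ d) := by gcongr
    _ = unitBallVolume d * R' ^ d * (lam * ρ - ε') * ρ := by ring
    _ = k / n - e := by rw [hRlam', mul_div_cancel₀ _ (by positivity)]

end Lookup

/-! ### Recovery of true clusters -/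

section Recovery

variable {d n k : ℕ} {X A A' S : Set (Space d)} {f : Space d → ℝ} {alg : Algorithm}
  {Cδ e q δ ε ε' α σ lam R : ℝ} {x : Fin n → Space d}

theorem IsDensityOn.le_of_mem_buffer (hf : IsDensityOn X f) {B Z : Set (Space d)}
    (hlam : lam = sInf (f '' B)) (hZ : Z ⊆ B) : ∀ z ∈ Z, lam ≤ f z := by
  intro z hz
  rw [hlam]
  refine csInf_le ⟨0, ?_⟩ ⟨z, hZ hz, rfl⟩
  rintro _ ⟨y, -, rfl⟩
  exact hf.nonneg y

theorem lt_of_supOn_lt {Z : Set (Space d)} {u : ℝ} (h : supOn f Z < (u : EReal)) :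
    ∀ z ∈ Z, f z < u :=
  fun _ hz => EReal.coe_lt_coe_iff.1 ((le_supOn hz).trans_lt h)

theorem Separates.disjoint (hS : Separates (convexHull ℝ X) S A A') (hAX : A ⊆ X) (hσ : 0 ≤ σ)
    {u : ℝ} (hA : ∀ z ∈ buffer A σ, u ≤ f z) (hu : ∀ z ∈ buffer S σ, f z < u) :
    Disjoint A A' := by
  refine Set.disjoint_left.2 fun a ha ha' => ?_
  obtain ⟨_, hs⟩ := hS a ha a ha' (Path.refl a) fun _ => subset_convexHull ℝ X (hAX ha)
  exact (hu a (mem_buffer_iff.2 ⟨a, hs, by simpa using hσ⟩)).not_ge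
    (hA a (mem_buffer_iff.2 ⟨a, ha, by simpa using hσ⟩))

theorem IsTypicalSample.not_reachable_levelGraph (hf : IsDensityOn X f)
    (hx : IsTypicalSample X f k e q x) (hα : α ≤ 2)
    (hS : Separates (convexHull ℝ X) S A A') (hR : 0 ≤ R) (hRσ : 2 * R ≤ σ) {u : ℝ}
    (hu : ∀ z ∈ buffer S σ, f z ≤ u) (hmass : u * (unitBallVolume d * R ^ d) ≤ k / n - e)
    {i j : Fin n} (hi : x i ∈ A) (hj : x j ∈ A') (hnode : i ∈ nodes k x (ENNReal.ofReal R)) :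
    ¬ (levelGraph alg α k x (ENNReal.ofReal R)).Reachable i j := by
  intro h
  obtain ⟨γ, hγ⟩ := joinedIn_of_reachable hR (fun _ _ => dist_le_of_levelGraph_adj hα hR) h
  obtain ⟨t, ht⟩ := hS _ hi _ hj γ fun t =>
    convexHull_mono (Set.range_subset_iff.2 hx.mem) (hγ t).1
  obtain ⟨-, m, him, hm⟩ := hγ t
  have hu' : ∀ z ∈ Metric.closedBall (x m) R, f z ≤ u := fun z hz => by
    refine hu z (mem_buffer_iff.2 ⟨_, ht, ?_⟩)
    linarith [dist_triangle_right z (γ t) (x m), Metric.mem_closedBall.1 hz]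
  have hu0 : 0 ≤ u := (hf.nonneg (x m)).trans (hu' _ (Metric.mem_closedBall_self hR))
  have hmem := mem_nodes_of_reachable_levelGraph hnode him
  rw [mem_nodes_ofReal_iff hR] at hmem
  exact hmem.not_gt (hx.ncard_lt m R ((densityMeasure_real_closedBall_le hR hu' hu0).trans hmass))

theorem IsDensityOn.recoversTrueClusters_of_subsingleton_nodes (hf : IsDensityOn X f)
    (hd : d ≠ 0) (hn : 1 ≤ n) (hk1 : 1 ≤ k) (hε : 0 < ε) (hε1 : ε < 1) (hε' : 0 < ε')
    (hσ : 0 < σ) (he0 : 0 ≤ deviation Cδ d n k) (he : deviation Cδ d n k ≤ ε / 5 * (k / n))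
    (hcount : ∀ i r, k / n + deviation Cδ d n k ≤
      (densityMeasure f).real (Metric.closedBall (x i) r) → k ≤ {j | dist (x j) (x i) ≤ r}.ncard)
    (hsub : ∀ R : ℝ, 0 ≤ R → (nodes k x (ENNReal.ofReal R)).Subsingleton) {C : ℝ} :
    RecoversTrueClusters alg X f C Cδ δ ε ε' α k σ x := by
  rintro A A' lam hAX - hlam hthr ⟨S, hS, hSlt⟩
  have hlam0 := pos_of_densityThreshold_le hn hk1 hε hε1 hε' hσ hthr
  have hbuffer : bufferDensity d n k σ * (1 + ε) ≤ lam := by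
    nlinarith [bufferDensity_mul_add_le hε1 hthr]
  obtain ⟨R, hR, hRσ, hRlev, hRlam⟩ := exists_levelRadius_le hd hn hk1 hε.le hσ he0 he hbuffer
  have hA := hf.le_of_mem_buffer hlam Set.subset_union_left
  have hA' := hf.le_of_mem_buffer hlam Set.subset_union_right
  have mem_nodes {B : Set (Space d)} (hB : ∀ z ∈ buffer B σ, lam ≤ f z) {l : Fin n}
      (hl : x l ∈ B) : l ∈ nodes k x (ENNReal.ofReal R) :=
    hf.mem_nodes_ofReal hcount hlam0.le hB hR.le hRσ hRlam hl (by simpa using hR.le)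
  have connected {B : Set (Space d)} (hB : ∀ z ∈ buffer B σ, lam ≤ f z) :
      SampleConnected alg α k Cδ ε' x (ENNReal.ofReal R) B := by
    intro i j hi hj
    have hi' := mem_nodes hB hi
    have hj' := mem_nodes hB hj
    exact ⟨hi', hj', hsub R hR.le hi' hj' ▸ .refl i⟩
  have hdisj : Disjoint A A' := hS.disjoint hAX hσ.le hA fun z hz =>
    (lt_of_supOn_lt hSlt z hz).trans (by nlinarith)
  rw [hRlev]
  refine ⟨fun _ => connected hA, fun _ => connected hA',
    fun i hi => hi.elim (mem_nodes hA) (mem_nodes hA'), fun i j hi hj _ => ?_⟩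
  obtain rfl := hsub R hR.le (mem_nodes hA hi) (mem_nodes hA' hj)
  exact Set.disjoint_left.1 hdisj hi hj

theorem hitMass_le (hδ : 0 < δ) (hδ1 : δ < 1) (hε : 0 < ε) (hε1 : ε < 1)
    (hk : 10000 * (d * Real.log n / ε ^ 2) * Real.log (2 / δ) ^ 2 ≤ (k : ℝ)) :
    hitMass d n δ ≤ k / n := by
  have hL := lt_log_two_div hδ hδ1
  have := Real.log_natCast_nonneg n
  rw [hitMass]
  gcongr
  calc 400 * (d * Real.log n * Real.log (2 / δ))
      ≤ 10000 * (d * Real.log n * Real.log (2 / δ)) * 0.69 := by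
        have : 0 ≤ d * Real.log n * Real.log (2 / δ) := by positivity
        linarith
    _ ≤ 10000 * (d * Real.log n * Real.log (2 / δ)) * Real.log (2 / δ) := by gcongr
    _ = 10000 * (d * Real.log n) * Real.log (2 / δ) ^ 2 := by ring
    _ ≤ ε ^ 2 * k := le_sq_mul_of_sampleSize hε hk
    _ ≤ k := mul_le_of_le_one_left (Nat.cast_nonneg _) (pow_le_one₀ hε.le hε1.le)

theorem IsTypicalSample.reachable_of_sampleSize (hd : 1 ≤ d) (hn : 2 ≤ n) (hk1 : 1 ≤ k)
    (hf : IsDensityOn X f) (hδ : 0 < δ) (hδ1 : δ < 1) (hε : 0 < ε) (hε1 : ε < 1) (hα : √2 ≤ α)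
    (hk : 10000 * (d * Real.log n / ε ^ 2) * Real.log (2 / δ) ^ 2 ≤ (k : ℝ))
    (hx : IsTypicalSample X f k (deviation (confidenceConst 10 δ) d n k) (hitMass d n δ) x)
    {lam' : ℝ} (hthr : densityThreshold alg X f 10000 δ ε ε' σ n k ≤ (lam : EReal))
    (hlam' : 0 < lam') (hlam : lam ≤ 2 * lam') (hA : ∀ z ∈ buffer A σ, lam' ≤ f z)
    (hR : 0 < R) (hRσ : 2 * R ≤ σ)
    (hRlam : unitBallVolume d * R ^ d * lam' = k / n + deviation (confidenceConst 10 δ) d n k)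
    (hconn : IsPreconnected A) {i j : Fin n} (hi : x i ∈ A) (hj : x j ∈ A) :
    (levelGraph alg α k x (ENNReal.ofReal R)).Reachable i j := by
  have hP : 0 < (k : ℝ) / n := div_pos (by exact_mod_cast hk1) (by positivity)
  have he := deviation_le (d := d) (n := n) (k := k) hε hk
  have he5 : deviation (confidenceConst 10 δ) d n k ≤ 1 / 5 * (k / n) := by nlinarith
  refine hx.reachable_levelGraph (by omega) hf (deviation_nonneg hδ hδ1) (by linarith)
    (hitMass_le hδ hδ1 hε hε1 hk) hα hlam' hA hR hRσ hRlam (fun halg => ?_) hconn hi hj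
  refine hf.exists_bound_of_densityThreshold_le hd hn hk1 hδ hδ1 halg he5 hlam'.le hlam
    (hlam'.trans_le (hA (x i) ?_)) hthr
  exact mem_buffer_iff.2 ⟨x i, hi, by simpa using (by linarith : 0 ≤ σ)⟩

theorem IsTypicalSample.recoversTrueClusters (hd : 1 ≤ d) (hn : 2 ≤ n) (hk1 : 1 ≤ k)
    (hf : IsDensityOn X f) (hδ : 0 < δ) (hδ1 : δ < 1) (hε : 0 < ε) (hε1 : ε < 1) (hε' : 0 < ε')
    (hα : √2 ≤ α) (hα2 : α ≤ 2)
    (hk : 10000 * (d * Real.log n / ε ^ 2) * Real.log (2 / δ) ^ 2 ≤ (k : ℝ))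
    (hx : IsTypicalSample X f k (deviation (confidenceConst 10 δ) d n k) (hitMass d n δ) x)
    (hσ : 0 < σ) :
    RecoversTrueClusters alg X f 10000 (confidenceConst 10 δ) δ ε ε' α k σ x := by
  rintro A A' lam - - hlam hthr ⟨S, hS, hSlt⟩
  have hd0 : d ≠ 0 := by omega
  have hn1 : 1 ≤ n := by omega
  have he0 := deviation_nonneg (d := d) (n := n) (k := k) hδ hδ1
  have he := deviation_le (d := d) (n := n) (k := k) hε hk
  have hbuffer := bufferDensity_mul_add_le hε1 hthr
  have hlam0 := pos_of_densityThreshold_le hn1 hk1 hε hε1 hε' hσ hthr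
  obtain ⟨R, hR, hRσ, hRlev, hRlam⟩ :=
    exists_levelRadius_le (lam := lam) hd0 hn1 hk1 hε.le hσ he0 he (by nlinarith)
  have hA := hf.le_of_mem_buffer hlam Set.subset_union_left
  have hA' := hf.le_of_mem_buffer hlam Set.subset_union_right
  have mem_nodes {B : Set (Space d)} (hB : ∀ z ∈ buffer B σ, lam ≤ f z) {l : Fin n}
      (hl : x l ∈ B) : l ∈ nodes k x (ENNReal.ofReal R) :=
    hf.mem_nodes_ofReal hx.le_ncard hlam0.le hB hR.le hRσ hRlam hl (by simpa using hR.le)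
  have connected {B : Set (Space d)} (hB : ∀ z ∈ buffer B σ, lam ≤ f z)
      (hconn : IsPathConnected B) :
      SampleConnected alg α k (confidenceConst 10 δ) ε' x (ENNReal.ofReal R) B :=
    fun i j hi hj => ⟨mem_nodes hB hi, mem_nodes hB hj,
      (hx.reachable_of_sampleSize hd hn hk1 hf hδ hδ1 hε hε1 hα hk hthr hlam0 (by linarith) hB hR
        hRσ hRlam hconn.isConnected.isPreconnected hi hj).mono levelGraph_le_prunedGraph⟩
  obtain ⟨R', hR', hRσ', hlookup, hRR', hmass⟩ :=
    exists_lookupRadius_eq hd0 hn1 hk1 hε hε1 hε'.le hσ he0 he hlam0 hbuffer hR hRlam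
  rw [hRlev] at hRR' ⊢
  refine ⟨connected hA, connected hA', fun i hi => hi.elim (mem_nodes hA) (mem_nodes hA'),
    fun i j hi hj hij => ?_⟩
  have hlevel := reachable_lookupRadius_of_reachable_prunedGraph (hlookup ▸ hRR') hij
  rw [hlookup] at hlevel
  exact hx.not_reachable_levelGraph hf hα2 hS hR'.le hRσ'
    (fun z hz => (lt_of_supOn_lt hSlt z hz).le) hmass hi hj ((mem_nodes hA hi).trans hRR') hlevel

end Recovery

/-! ### Removal of false clusters -/

section Removal

variable {d n k : ℕ} {X : Set (Space d)} {f : Space d → ℝ} {alg : Algorithm}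
  {Cδ q δ ε ε' α σ R : ℝ} {x : Fin n → Space d} {r : ℝ≥0∞} {T T' : Set (Fin n)}

theorem abs_sub_le_of_two_mul_oscillation_le (h : 2 * oscillation f σ ≤ (ε' : EReal))
    {z z' : Space d} (hz : dist z z' ≤ σ) : |f z - f z'| ≤ ε' / 2 := by
  have hle : ((|f z - f z'| : ℝ) : EReal) ≤ oscillation f σ := by
    rw [dist_eq_norm] at hz
    exact le_iSup_of_le z (le_iSup_of_le z' (le_iSup_of_le hz le_rfl))
  have htwo : ((2 * |f z - f z'| : ℝ) : EReal) ≤ ε' := by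
    rw [EReal.coe_mul]
    exact (mul_le_mul_of_nonneg_left hle zero_le_two).trans h
  linarith [EReal.coe_le_coe_iff.1 htwo]

theorem IsPrunedCluster.subset_nodes (hT : IsPrunedCluster alg α k Cδ ε' x r T) :
    T ⊆ nodes k x r := by
  obtain ⟨_, -, rfl⟩ := hT
  exact fun _ h => h.1

theorem IsPrunedCluster.mem_of_reachable (hT : IsPrunedCluster alg α k Cδ ε' x r T) {i j : Fin n}
    (hi : i ∈ T) (hj : j ∈ nodes k x r) (h : (prunedGraph alg α k Cδ ε' x r).Reachable i j) :
    j ∈ T := by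
  obtain ⟨_, -, rfl⟩ := hT
  exact ⟨hj, hi.2.trans h⟩

theorem IsPrunedCluster.not_disjoint_of_reachable_lookupRadius
    (hT : IsPrunedCluster alg α k Cδ ε' x r T) (hT' : IsPrunedCluster alg α k Cδ ε' x r T')
    {i j : Fin n} (hi : i ∈ T) (hj : j ∈ T')
    (h : (levelGraph alg α k x (lookupRadius Cδ ε' d n k r)).Reachable i j) :
    ¬ Disjoint T T' := by
  refine Set.not_disjoint_iff.2 ⟨j, ?_, hj⟩
  rcases eq_or_ne i j with rfl | hij
  · exact hi
  have hadj : (prunedGraph alg α k Cδ ε' x r).Adj i j :=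
    ⟨hij, hT.subset_nodes hi, hT'.subset_nodes hj, Or.inr h⟩
  exact hT.mem_of_reachable hi (hT'.subset_nodes hj) hadj.reachable

theorem removesFalseClusters_of_subsingleton_nodes {C : ℝ}
    (hsub : ∀ R : ℝ, 0 ≤ R → (nodes k x (ENNReal.ofReal R)).Subsingleton) :
    RemovesFalseClusters alg X f C Cδ δ ε ε' α k σ x := by
  intro _ R T T' _ hR hT hT' hdisj _ _ i hi j hj _
  obtain rfl := hsub R hR.le (hT.subset_nodes hi) (hT'.subset_nodes hj)
  exact Set.disjoint_left.1 hdisj hi hj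

theorem IsTypicalSample.lookupDensity_le (hn : 1 ≤ n) (hf : IsDensityOn X f)
    (hx : IsTypicalSample X f k (deviation Cδ d n k) q x) (he0 : 0 ≤ deviation Cδ d n k)
    (hσ : 0 < σ) (hosc : ∀ z z', dist z z' ≤ σ → |f z - f z'| ≤ ε' / 2) (hR : 0 < R) {m : Fin n}
    (hm : m ∈ nodes k x (ENNReal.ofReal R)) (hfm : bufferDensity d n k σ ≤ f (x m)) :
    lookupDensity Cδ ε' d n k (ENNReal.ofReal R) ≤ f (x m) - ε' / 2 := by
  have hv := unitBallVolume_pos d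
  have hε' : 0 ≤ ε' / 2 := (abs_nonneg _).trans (hosc (x m) (x m) (by simpa using hσ.le))
  have hfm0 : 0 ≤ f (x m) := hf.nonneg (x m)
  suffices k / n - deviation Cδ d n k ≤ (f (x m) + ε' / 2) * (unitBallVolume d * R ^ d) by
    rw [← div_le_iff₀ (by positivity)] at this
    rw [lookupDensity_ofReal hR]
    linarith
  rcases le_total R σ with hRσ | hRσ
  · rw [mem_nodes_ofReal_iff hR.le] at hm
    have hmass := not_le.1 (mt (hx.ncard_lt m R) hm.not_gt)
    refine hmass.le.trans (densityMeasure_real_closedBall_le hR.le (fun z hz => ?_) (by positivity))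
    linarith [le_abs_self (f z - f (x m)), hosc z (x m) ((Metric.mem_closedBall.1 hz).trans hRσ)]
  · calc k / n - deviation Cδ d n k ≤ k / n := sub_le_self _ he0
      _ = bufferDensity d n k σ * (unitBallVolume d * (σ / 2) ^ d) :=
          (bufferDensity_mul hn hσ).symm
      _ ≤ (f (x m) + ε' / 2) * (unitBallVolume d * R ^ d) := by
          gcongr <;> linarith

theorem IsTypicalSample.removesFalseClusters (hd : 1 ≤ d) (hn : 2 ≤ n) (hk1 : 1 ≤ k)
    (hf : IsDensityOn X f) (hδ : 0 < δ) (hδ1 : δ < 1) (hε : 0 < ε) (hε1 : ε < 1) (hε' : 0 < ε')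
    (hα : √2 ≤ α)
    (hk : 10000 * (d * Real.log n / ε ^ 2) * Real.log (2 / δ) ^ 2 ≤ (k : ℝ))
    (hx : IsTypicalSample X f k (deviation (confidenceConst 10 δ) d n k) (hitMass d n δ) x)
    (hσ : 0 < σ) :
    RemovesFalseClusters alg X f 10000 (confidenceConst 10 δ) δ ε ε' α k σ x := by
  intro hoscillation r T T' lam hr hT hT' hdisj hlam hthr i hi j hj hjoin
  have hosc : ∀ z z', dist z z' ≤ σ → |f z - f z'| ≤ ε' / 2 :=
    fun _ _ => abs_sub_le_of_two_mul_oscillation_le hoscillation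
  have hn1 : 1 ≤ n := by omega
  have he0 := deviation_nonneg (d := d) (n := n) (k := k) hδ hδ1
  have he := deviation_le (d := d) (n := n) (k := k) hε hk
  have hbuffer := bufferDensity_mul_add_le hε1 hthr
  have hbuffer0 := bufferDensity_pos (d := d) hn1 hk1 hσ
  have hlam0 := pos_of_densityThreshold_le hn1 hk1 hε hε1 hε' hσ hthr
  have hlam' : bufferDensity d n k σ * (1 + ε) ≤ lam - ε' / 2 := by nlinarith
  obtain ⟨R, hR, hRσ, hRlev, hRlam⟩ := exists_levelRadius_le (by omega) hn1 hk1 hε.le hσ he0 he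
    hlam'
  have hlookup : ENNReal.ofReal R ≤
      lookupRadius (confidenceConst 10 δ) ε' d n k (ENNReal.ofReal r) := by
    obtain ⟨m, hm, hfm⟩ : lam ∈ (fun i => f (x i)) '' (T ∪ T') :=
      hlam ▸ Set.Nonempty.csInf_mem ⟨_, i, Or.inl hi, rfl⟩ (Set.toFinite _)
    have hle := hx.lookupDensity_le hn1 hf he0 hσ hosc hr
      (hm.elim (hT.subset_nodes ·) (hT'.subset_nodes ·)) (by nlinarith)
    rw [← hRlev, lookupRadius]
    exact levelRadius_antitone _ _ _ _ (max_le (hfm ▸ hle) (by nlinarith))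
  set A := pathComponentIn {y | y ∈ X ∧ lam ≤ f y} (x i)
  have hA : ∀ z ∈ buffer A σ, lam - ε' / 2 ≤ f z := by
    intro z hz
    obtain ⟨y, hy, hzy⟩ := mem_buffer_iff.1 hz
    linarith [neg_abs_le (f z - f y), hosc z y hzy, (pathComponentIn_subset hy).2]
  have hreach := hx.reachable_of_sampleSize hd hn hk1 hf hδ hδ1 hε hε1 hα hk hthr
    (by nlinarith) (by nlinarith) hA hR hRσ hRlam
    (isPathConnected_pathComponentIn hjoin.source_mem).isConnected.isPreconnected
    (mem_pathComponentIn_self hjoin.source_mem) hjoin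
  exact hT.not_disjoint_of_reachable_lookupRadius hT' hi hj
    (hreach.mono (levelGraph_mono hlookup)) hdisj

end Removal

/-! ### Small samples -/

section SmallSample

variable {d n k : ℕ} {X : Set (Space d)} {f : Space d → ℝ} {e R : ℝ} {x : Fin n → Space d}

theorem subsingleton_nodes_ofReal (h : n ≤ 1 ∨ n < k) (hR : 0 ≤ R) :
    (nodes k x (ENNReal.ofReal R)).Subsingleton := by
  intro i hi j _
  rcases h with hn | hnk
  · have := Fin.subsingleton_iff_le_one.2 hn
    exact Subsingleton.elim i j
  · rw [mem_nodes_ofReal_iff hR] at hi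
    have hcard : {j | dist (x j) (x i) ≤ R}.ncard ≤ n := by
      simpa using Set.ncard_le_card {j | dist (x j) (x i) ≤ R}
    omega

theorem IsDensityOn.le_ncard_of_le_one_or_lt (hf : IsDensityOn X f) (hn : 1 ≤ n) (hk1 : 1 ≤ k)
    (h : n ≤ 1 ∨ n < k) (he : 0 ≤ e) (i : Fin n) (r : ℝ)
    (hmass : k / n + e ≤ (densityMeasure f).real (Metric.closedBall (x i) r)) :
    k ≤ {j | dist (x j) (x i) ≤ r}.ncard := by
  have := hf.isProbabilityMeasure
  have hn0 : (0 : ℝ) < n := by exact_mod_cast hn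
  have hk0 : (0 : ℝ) < k := by exact_mod_cast hk1
  have hkn : k ≤ n := by
    have hle : k / n + e ≤ 1 := hmass.trans measureReal_le_one
    exact_mod_cast (div_le_one hn0).1 (by linarith : (k : ℝ) / n ≤ 1)
  have hr : 0 ≤ r := by
    by_contra! hr
    rw [Metric.closedBall_eq_empty.2 hr, measureReal_empty] at hmass
    linarith [div_pos hk0 hn0]
  have hpos : 0 < {j | dist (x j) (x i) ≤ r}.ncard :=
    (Set.ncard_pos (Set.toFinite _)).2 ⟨i, by simpa using hr⟩
  omega

end SmallSample

theorem exists_measurableSet_forall_of_measureReal_not_le {Ω : Type*} [MeasurableSpace Ω]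
    {μ : Measure Ω} [IsProbabilityMeasure μ] {p : Ω → Prop} {δ : ℝ} (hδ : 0 ≤ δ)
    (h : μ.real {ω | ¬ p ω} ≤ δ) :
    ∃ E, MeasurableSet E ∧ ENNReal.ofReal (1 - δ) ≤ μ E ∧ ∀ ω ∈ E, p ω := by
  refine ⟨(toMeasurable μ {ω | ¬ p ω})ᶜ, (measurableSet_toMeasurable _ _).compl, ?_,
    fun ω hω => not_not.1 fun hp => hω (subset_toMeasurable _ _ hp)⟩
  rw [prob_compl_eq_one_sub (measurableSet_toMeasurable _ _), measure_toMeasurable,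
    ENNReal.ofReal_sub _ hδ, ENNReal.ofReal_one]
  exact tsub_le_tsub_left ((ENNReal.le_ofReal_iff_toReal_le (measure_ne_top _ _) hδ).2 h) _

end ClusterTree

end

theorem mainTheorem5 :
    ∃ C₀ : ℝ, 0 < C₀ ∧ ∃ C : ℝ, 0 < C ∧
      ∀ (d n k : ℕ) (X : Set (ClusterTree.Space d)) (f : ClusterTree.Space d → ℝ)
        (δ ε ε' α : ℝ) (alg : ClusterTree.Algorithm),
        1 ≤ d → 1 ≤ n → 1 ≤ k →
        ClusterTree.IsDensityOn X f →
        0 < δ → δ < 1 → 0 < ε → ε < 1 → 0 < ε' →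
        √2 ≤ α → α ≤ 2 →
        C * (d * Real.log n / ε ^ 2) * Real.log (2 / δ) ^ 2 ≤ (k : ℝ) →
        ∃ E : Set (Fin n → ClusterTree.Space d), MeasurableSet E ∧
          ENNReal.ofReal (1 - δ) ≤ ClusterTree.sampleMeasure f n E ∧
          ∀ x ∈ E, ∀ σ : ℝ, 0 < σ →
            ClusterTree.RecoversTrueClusters alg X f C (ClusterTree.confidenceConst C₀ δ)
              δ ε ε' α k σ x ∧
            ClusterTree.RemovesFalseClusters alg X f C (ClusterTree.confidenceConst C₀ δ)
              δ ε ε' α k σ x := by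
  refine ⟨10, by norm_num, 10000, by norm_num, ?_⟩
  intro d n k X f δ ε ε' α alg hd hn hk1 hf hδ hδ1 hε hε1 hε' hα hα2 hk
  have := hf.isProbabilityMeasure_sampleMeasure n
  by_cases hlarge : 2 ≤ n ∧ k ≤ n
  · obtain ⟨hn2, hkn⟩ := hlarge
    obtain ⟨E, hE, hprob, htypical⟩ :=
      ClusterTree.exists_measurableSet_forall_of_measureReal_not_le hδ.le
        (hf.measureReal_not_isTypicalSample_le_of_sampleSize hd hn2 hk1 hkn hδ hδ1 hε hε1 hk)
    exact ⟨E, hE, hprob, fun x hx σ hσ =>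
      ⟨(htypical x hx).recoversTrueClusters hd hn2 hk1 hf hδ hδ1 hε hε1 hε' hα hα2 hk hσ,
        (htypical x hx).removesFalseClusters hd hn2 hk1 hf hδ hδ1 hε hε1 hε' hα hk hσ⟩⟩
  · have hsmall : n ≤ 1 ∨ n < k := by omega
    refine ⟨Set.univ, .univ, ?_, fun x _ σ hσ => ?_⟩
    · rw [measure_univ]
      exact ENNReal.ofReal_le_one.2 (by linarith)
    have hsub (R : ℝ) (hR : 0 ≤ R) := ClusterTree.subsingleton_nodes_ofReal (x := x) hsmall hR
    have he0 := ClusterTree.deviation_nonneg (d := d) (n := n) (k := k) hδ hδ1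
    exact ⟨hf.recoversTrueClusters_of_subsingleton_nodes (by omega) hn hk1 hε hε1 hε' hσ he0
        (ClusterTree.deviation_le hε hk) (hf.le_ncard_of_le_one_or_lt hn hk1 hsmall he0) hsub,
      ClusterTree.removesFalseClusters_of_subsingleton_nodes hsub⟩
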